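/- Let $k$ be a field and let $X$ be a smooth projective irreducible surface over $k$. For a field extension $K/k$ and a $K$-point $P\colon \operatorname{Spec} K\to X$ over $k$, let $\operatorname{trdeg}(P/k)$ denote the transcendence degree over $k$ of the residue field of $X$ at the image of $P$. A rational curve on $X_K=X\times_k K$ is an integral closed subscheme $C\subset X_K$ which is birational over $K$ to $\mathbb P^1_K$; it passes through $P$ if it contains the image of the $K$-rational point of $X_K$ defined by $P$. Call $X$ uniruled if there are an integral separated scheme $Y$ of finite type over $k$ with $\dim Y=\dim X-1$ and a dominant rational map $\mathbb P^1\times_k Y\dashrightarrow X$ over $k$. (1) Suppose that for some field extension $K/k$ there is a $K$-point $P$ of $X$ over $k$ with $\operatorname{trdeg}(P/k)=2$ such that a rational curve on $X_K$ passes through $P$. Then $X$ is uniruled. (2) Suppose that $\operatorname{char} k=0$ and that $X$ is of general type, i.e. for some $m>0$ the rational map defined by $|mK_X|$ has a $2$-dimensional image. Then for every field extension $K/k$ and every $K$-point $P$ of $X$ over $k$ with $\operatorname{trdeg}(P/k)=2$, no rational curve on $X_K$ passes through $P$. In particular, for every extension $K/k$ and every $k$-embedding $k(X)\hookrightarrow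 K$, no rational curve on $X_K$ passes through the $K$-point $P_\eta$ obtained from the generic point $\operatorname{Spec} k(X)\to X$. -/

import Mathlib

universe u

open CategoryTheory CategoryTheory.Limits AlgebraicGeometry

noncomputable section

attribute [local instance] MvPolynomial.gradedAlgebra

/-- The projective space `ℙⁿ` over a field `k`, as the Proj of `k[x₀, …, xₙ]`. -/
def projSpace (n : ℕ) (k : Type u) [Field k] : Scheme.{u} :=
  Proj (MvPolynomial.homogeneousSubmodule (Fin (n + 1)) k)

/-- The structure morphism `ℙⁿ ⟶ Spec k`. -/
def projSpaceStr (n : ℕ) (k : Type u) [Field k] :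
    projSpace n k ⟶ Spec (CommRingCat.of k) :=
  Proj.toSpecZero (MvPolynomial.homogeneousSubmodule (Fin (n + 1)) k) ≫
    Spec.map (CommRingCat.ofHom
      (algebraMap k (MvPolynomial.homogeneousSubmodule (Fin (n + 1)) k 0)))

section Varieties

variable {k : Type u} [Field k] {X : Scheme.{u}}

/-- A `k`-scheme is projective if it has a closed immersion over `k` into some `ℙⁿ`. -/
def IsProjectiveOverField (s : X ⟶ Spec (CommRingCat.of k)) : Prop :=
  ∃ (n : ℕ) (i : X ⟶ projSpace n k), IsClosedImmersion i ∧ i ≫ projSpaceStr n k = s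

/-- A variety over `k`: an integral separated scheme of finite type over `k`. -/
structure IsVarietyOverField (s : X ⟶ Spec (CommRingCat.of k)) : Prop where
  integral : IsIntegral X
  separated : IsSeparated s
  locallyOfFiniteType : LocallyOfFiniteType s
  quasiCompact : QuasiCompact s

/-- A smooth projective (irreducible) surface over `k`. -/
structure IsSmoothProjectiveSurface (s : X ⟶ Spec (CommRingCat.of k)) : Prop where
  integral : IsIntegral X
  smooth : Smooth s
  projective : IsProjectiveOverField s
  dim_eq : topologicalKrullDim X = 2

/-- A `k`-variety `X` is uniruled if there are a `k`-variety `Y` of dimension `dim X - 1` and a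
dominant rational map `ℙ¹ ×ₖ Y ⤏ X` over `k`. -/
def IsUniruled (s : X ⟶ Spec (CommRingCat.of k)) : Prop :=
  ∃ (Y : Scheme.{u}) (t : Y ⟶ Spec (CommRingCat.of k)),
    IsVarietyOverField t ∧ topologicalKrullDim Y + 1 = topologicalKrullDim X ∧
      ∃ f : Scheme.RationalMap (pullback (projSpaceStr 1 k) t) X,
        f.IsDominant ∧ f.compHom s = (pullback.snd (projSpaceStr 1 k) t ≫ t).toRationalMap

/-- For a `k`-scheme `X` and a morphism `Spec A ⟶ X`, the induced `k`-algebra structure on `A`. -/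
abbrev algebraOfPoint (s : X ⟶ Spec (CommRingCat.of k)) {A : CommRingCat.{u}}
    (f : Spec A ⟶ X) : Algebra k A :=
  (Spec.preimage (f ≫ s)).hom.toAlgebra

/-- The transcendence degree over `k` of a point `P : Spec K ⟶ X` of a `k`-scheme `X`: the
transcendence degree over `k` of the residue field of `X` at the image of `P`. -/
def pointTrdeg (s : X ⟶ Spec (CommRingCat.of k)) {K : Type u} [Field K]
    (P : Spec (CommRingCat.of K) ⟶ X) : Cardinal.{u} :=
  letI := algebraOfPoint s (X.fromSpecResidueField (P (IsLocalRing.closedPoint K)))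
  Algebra.trdeg k (X.residueField (P (IsLocalRing.closedPoint K)))

/-- A rational curve on a `K`-scheme `Z`: an integral closed subscheme `i : C ⟶ Z` which is
birational over `K` to `ℙ¹`. -/
structure IsRationalCurve {K : Type u} [Field K] {C Z : Scheme.{u}}
    (z : Z ⟶ Spec (CommRingCat.of K)) (i : C ⟶ Z) : Prop where
  integral : IsIntegral C
  closedImmersion : IsClosedImmersion i
  birational : Scheme.BirationalOver (i ≫ z) (projSpaceStr 1 K)

/-- The morphism `Spec K ⟶ Spec k` given by a field extension `K / k`. -/
abbrev specExt (k K : Type u) [Field k] [Field K] [Algebra k K] :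
    Spec (CommRingCat.of K) ⟶ Spec (CommRingCat.of k) :=
  Spec.map (CommRingCat.ofHom (algebraMap k K))

/-- Some rational curve on the base change `X_K` passes through the `K`-point `P` of the
`k`-scheme `X`, that is, through the image of the section of `X_K ⟶ Spec K` given by `P`. -/
def RationalCurveThrough (s : X ⟶ Spec (CommRingCat.of k)) {K : Type u} [Field K] [Algebra k K]
    (P : Spec (CommRingCat.of K) ⟶ X) (hP : P ≫ s = specExt k K) : Prop :=
  ∃ (C : Scheme.{u}) (i : C ⟶ pullback s (specExt k K)),
    IsRationalCurve (pullback.snd s (specExt k K)) i ∧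
      (pullback.lift P (𝟙 _) (by simpa using hP) :
        Spec (CommRingCat.of K) ⟶ pullback s (specExt k K)) (IsLocalRing.closedPoint K) ∈
          Set.range i

end Varieties

section GeneralType

open scoped TensorProduct

/-- Rational `m`-canonical forms on a surface with function field `F` over `k`: the elements of
the `m`-th tensor power over `F` of `⋀² Ω_{F/k}`. -/
abbrev RationalPluriform (k F : Type u) [Field k] [Field F] [Algebra k F] (m : ℕ) : Type u :=
  PiTensorProduct F (fun _ : Fin m => ⋀[F]^2 (Ω[F⁄k]))

/-- The forms that are regular along the local ring `O`: the image of the `m`-th tensor power over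
`O` of `⋀² Ω_{O/k}`, which is generated over `O` by the products of forms `da ∧ db` with
`a, b ∈ O`. -/
def regularPluriforms (k : Type u) {F : Type u} [Field k] [Field F] [Algebra k F] (m : ℕ)
    (O : Subring F) : Submodule O (RationalPluriform k F m) :=
  Submodule.span O
    {w | ∃ a b : Fin m → O, w = PiTensorProduct.tprod F (fun j =>
      exteriorPower.ιMulti F 2 ![KaehlerDifferential.D k F (a j), KaehlerDifferential.D k F (b j)])}

variable {k : Type u} [Field k] {X : Scheme.{u}} [IsIntegral X]

/-- The function field of a `k`-scheme as a `k`-algebra. -/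
abbrev functionFieldAlgebra (s : X ⟶ Spec (CommRingCat.of k)) : Algebra k X.functionField :=
  algebraOfPoint s (X.fromSpecStalk (genericPoint X))

/-- The local ring of `X` at `x`, as a subring of the function field. -/
def localSubring (X : Scheme.{u}) [IsIntegral X] (x : X) : Subring X.functionField :=
  (algebraMap (X.presheaf.stalk x) X.functionField).range

/-- The global sections of `ω_X^{⊗ m}` on a smooth surface `X` over `k`. As `ω_X^{⊗ m}` is
invertible and `X` is integral, these are the rational `m`-canonical forms that are regular at
every point of `X`. -/
def pluricanonicalSections (s : X ⟶ Spec (CommRingCat.of k)) (m : ℕ) :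
    letI := functionFieldAlgebra s
    Set (RationalPluriform k X.functionField m) :=
  letI := functionFieldAlgebra s
  {w | ∀ x : X, w ∈ regularPluriforms k m (localSubring X x)}

/-- The dimension of the image of the rational map defined by `|m K_X|`: its function field is
generated over `k` by the quotients of global sections of `ω_X^{⊗ m}`. -/
def pluricanonicalImageDim (s : X ⟶ Spec (CommRingCat.of k)) (m : ℕ) : Cardinal.{u} :=
  letI := functionFieldAlgebra s
  Algebra.trdeg k (IntermediateField.adjoin k
    {f : X.functionField | ∃ v ∈ pluricanonicalSections s m, ∃ w ∈ pluricanonicalSections s m,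
      v ≠ 0 ∧ w = f • v})

/-- A smooth projective surface is of general type if its Kodaira dimension is `2`: for some
`m > 0` the image of the rational map defined by `|m K_X|` has dimension `2`. -/
def IsOfGeneralType (s : X ⟶ Spec (CommRingCat.of k)) : Prop :=
  ∃ m : ℕ, 0 < m ∧ pluricanonicalImageDim s m = 2

/-- The point `P_η` of `X` with values in an extension `K` of the function field: the generic
point `Spec k(X) ⟶ X` composed with the morphism given by an embedding `e : k(X) → K`. -/
def genericKPoint (X : Scheme.{u}) [IsIntegral X] {K : Type u} [Field K]
    (e : X.functionField →+* K) : Spec (CommRingCat.of K) ⟶ X :=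
  Spec.map (CommRingCat.ofHom e) ≫ X.fromSpecStalk (genericPoint X)

end GeneralType

end

/-! On a surface, a point whose residue field has transcendence degree two is the generic point `η`.
A rational curve in `X_K` has a generic point `Spec K(t) ⟶ X_K`. If the curve passes through a
`K`-point lying over `η`, the generic point of the curve also lies over `η`, since only `η`
specializes to `η`. This gives a `k`-embedding `φ : k(X) → K(t)`
(`RationalCurveThrough.exists_algHom`). Its values are not all constants: otherwise the monomorphism
`Spec K(t) ⟶ X_K` would factor through `Spec K` (`exists_ne_C_of_mono`). Both claims are then
statements about `φ`, with `K` an arbitrary, possibly huge, field.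

The common tool is `exists_isTranscendenceBasis_comp_ratFunc`: there are constants `Z ⊆ K`,
independent over `k`, such that the image of a transcendence basis of `k(X)` is a transcendence
basis of `K(t)` over `B = k[Z]`. Thus `K` has transcendence degree one over `B`.

Uniruledness comes from specializing the parameters `Z` to algebraic numbers over `k`, which cuts
the family of curves down to a one-parameter family. For a general choice the two basis elements
stay independent, so `k(X)` still embeds, while the coefficients of `φ` become pairwise dependent
over `k` and generate the coordinate ring `A` of a curve (`exists_curve_algHom_of_algHom_ratFunc`).
An embedding `k(X) → Frac A[t]` is a dominant rational map from `ℙ¹ × Spec A`.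

For general type, a pluricanonical form is pulled back to `ℙ¹` over `K` and evaluated on two
derivations of `K(t)`: one extending a derivation of `K`, and `d/dt`. In characteristic zero their
Jacobian on the basis is nonzero. By properness every valuation ring of `K(t)` over `K` has a centre
on `X`, so the value is a polynomial in `t`. Replacing `d/dt` by `t² d/dt`, which is regular at
infinity, shows that `t^(2m)` times the value is a polynomial in `1/t`. Hence the value, and so the
form, is zero (`pluriform_eq_zero_of_forall_valuationSubring`). No nonzero pluricanonical sections
exist, contrary to general type. -/

/-! ### Krull dimension and transcendence degree of finitely generated domains. -/

section Dimension

/-- An injective integral extension preserves the Krull dimension. -/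
theorem ringKrullDim_eq_of_isIntegral_of_injective {R S : Type*} [CommRing R] [CommRing S] [IsDomain S]
    [Algebra R S] [Algebra.IsIntegral R S] (hinj : Function.Injective (algebraMap R S)) :
    ringKrullDim S = ringKrullDim R := by
  apply le_antisymm
  · refine Order.krullDim_le_of_strictMono (PrimeSpectrum.comap (algebraMap R S)) ?_
    intro p q hpq
    have : p.asIdeal < q.asIdeal := hpq
    exact Ideal.IsIntegral.comap_lt_comap this
  · refine iSup_le fun l => ?_
    have hbot : RingHom.ker (algebraMap R S) ≤ l.head.asIdeal := by
      rw [(RingHom.injective_iff_ker_eq_bot _).mp hinj]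
      exact bot_le
    -- Lying over lifts the bottom of a chain of primes, going up lifts the rest.
    obtain ⟨Q, hQ, hQl⟩ := Ideal.exists_ideal_over_prime_of_isIntegral_of_isDomain
      (S := S) l.head.asIdeal hbot
    have : Q.LiesOver l.head.asIdeal := ⟨hQl.symm⟩
    obtain ⟨L, hL, -⟩ := Ideal.exists_ltSeries_of_hasGoingUp l Q
    rw [← hL]
    exact le_iSup (fun p : LTSeries (PrimeSpectrum S) => (p.length : WithBot ℕ∞)) L

/-- The Krull dimension of a finitely generated domain over a field is its transcendence
degree. -/
theorem exists_ringKrullDim_eq_and_trdeg_eq (k A : Type u) [Field k] [CommRing A] [IsDomain A]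
    [Algebra k A] [Algebra.FiniteType k A] :
    ∃ n : ℕ, ringKrullDim A = n ∧ Algebra.trdeg k A = n := by
  obtain ⟨n, g, hinj, hint⟩ := exists_integral_inj_algHom_of_fg k A
  refine ⟨n, ?_, ?_⟩
  · let := g.toRingHom.toAlgebra
    have : Algebra.IsIntegral (MvPolynomial (Fin n) k) A := ⟨hint⟩
    rw [ringKrullDim_eq_of_isIntegral_of_injective (R := MvPolynomial (Fin n) k) (S := A) hinj,
      MvPolynomial.ringKrullDim_of_isNoetherianRing, ringKrullDim_eq_zero_of_field]
    simp
  · let := g.toRingHom.toAlgebra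
    have : IsScalarTower k (MvPolynomial (Fin n) k) A :=
      IsScalarTower.of_algebraMap_eq fun x => (g.commutes x).symm
    have : Algebra.IsIntegral (MvPolynomial (Fin n) k) A := ⟨hint⟩
    have : FaithfulSMul (MvPolynomial (Fin n) k) A :=
      (faithfulSMul_iff_algebraMap_injective _ _).mpr hinj
    rw [← trdeg_add_eq k (MvPolynomial (Fin n) k),
      trdeg_eq_zero (R := MvPolynomial (Fin n) k), MvPolynomial.trdeg_of_isDomain]
    simp

theorem trdeg_eq_of_isFractionRing (k A F : Type u) [Field k] [CommRing A] [IsDomain A]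
    [Algebra k A] [Field F] [Algebra k F] [Algebra A F] [IsScalarTower k A F] [IsFractionRing A F] :
    Algebra.trdeg k F = Algebra.trdeg k A := by
  have : Algebra.IsAlgebraic A F := IsLocalization.isAlgebraic _ (nonZeroDivisors A)
  rw [← trdeg_add_eq k A (A := F), trdeg_eq_zero (R := A), add_zero]

end Dimension


/-! ### Transcendence bases of `K(t)` completed by constants. -/

section TranscendenceBasis

/-- The two subalgebras may live over unrelated base rings; this permits changing the ground ring
among `K`, `k` and `k[Z]`. -/
theorem Algebra.IsAlgebraic.of_subalgebra_subset {R₁ R₂ E : Type*} [CommRing R₁] [CommRing R₂]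
    [Field E] [Algebra R₁ E] [Algebra R₂ E] {S₁ : Subalgebra R₁ E} {S₂ : Subalgebra R₂ E}
    (h : (S₁ : Set E) ⊆ S₂) [Algebra.IsAlgebraic S₁ E] : Algebra.IsAlgebraic S₂ E := by
  let f : S₁ →+* S₂ := S₁.val.toRingHom.codRestrict S₂ fun x => h x.2
  let := f.toAlgebra
  have : IsScalarTower S₁ S₂ E := IsScalarTower.of_algebraMap_eq fun _ => rfl
  refine Algebra.IsAlgebraic.extendScalars (R := S₁) (S := S₂) (A := E) ?_
  intro x y hxy
  exact Subtype.ext (congrArg (fun z : S₂ => (z : E)) hxy)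

variable {k F K : Type u} [Field k] [Field F] [Field K] [Algebra k F] [Algebra k K]

theorem trdeg_ratFunc (K : Type u) [Field K] : Algebra.trdeg K (RatFunc K) = 1 := by
  rw [trdeg_eq_of_isFractionRing K (Polynomial K) (RatFunc K), Polynomial.trdeg_of_isDomain]

/-- A nonconstant `f` is transcendental over `K`, and `K(t)` has transcendence degree one, so `f`
alone is a transcendence basis. -/
theorem RatFunc.isAlgebraic_adjoin_singleton_of_ne_C {f : RatFunc K}
    (hf : ¬ ∃ c, f = RatFunc.C c) :
    Algebra.IsAlgebraic (Algebra.adjoin K {f}) (RatFunc K) := by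
  have h1 : AlgebraicIndependent K (fun _ : Unit => f) := by
    rw [algebraicIndependent_unique_type_iff]
    exact RatFunc.transcendental_of_ne_C f hf
  have h2 := h1.isTranscendenceBasis_of_lift_trdeg_le_of_finite (by simp [trdeg_ratFunc])
  have h3 := h2.isAlgebraic
  rwa [Set.range_const] at h3

/-- Given an embedding of a field of transcendence degree two into `K(t)`, not all of whose values
are constants, a transcendence basis of the source can be completed by constants to a
transcendence basis of `K(t)`. -/
theorem exists_isTranscendenceBasis_comp_ratFunc (φ : F →ₐ[k] RatFunc K)
    (htr : Algebra.trdeg k F = 2) (hφ : ∃ a, ¬ ∃ c, φ a = RatFunc.C c) :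
    ∃ (x : Fin 2 → F) (Z : Set K), IsTranscendenceBasis k x ∧
      AlgebraicIndependent k ((↑) : Z → K) ∧
      IsTranscendenceBasis (Algebra.adjoin k Z) (φ ∘ x) := by
  obtain ⟨a, ha⟩ := hφ
  have ha1 : Transcendental k (φ a) := fun h =>
    RatFunc.transcendental_of_ne_C _ ha (h.tower_top K)
  have ha2 : Transcendental k a := fun h => ha1 (h.algHom φ)
  -- Having `a` in the basis makes `K(t)` algebraic over `φ ∘ x` together with the constants,
  -- because `φ a` is nonconstant. So the basis can be completed by constants only.
  obtain ⟨s, has, hs⟩ := exists_isTranscendenceBasis_superset (R := k) (s := {a})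
    (by simpa [AlgebraicIndepOn, algebraicIndependent_unique_type_iff] using ha2)
  have hcard : Cardinal.mk s = 2 := by rw [hs.cardinalMk_eq_trdeg, htr]
  obtain ⟨e⟩ : Nonempty (Fin 2 ≃ s) := by
    rw [← Cardinal.lift_mk_eq']
    simp [hcard]
  set x : Fin 2 → F := fun i => e i with hxdef
  have hx : IsTranscendenceBasis k x := hs.comp_equiv e
  have hind : AlgebraicIndependent k (φ ∘ x) := hx.1.map' φ.injective
  have halg : Algebra.IsAlgebraic (Algebra.adjoin k
      (Set.range (φ ∘ x) ∪ Set.range (RatFunc.C (K := K)))) (RatFunc K) := by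
    have := RatFunc.isAlgebraic_adjoin_singleton_of_ne_C ha
    refine Algebra.IsAlgebraic.of_subalgebra_subset (S₁ := Algebra.adjoin K {φ a}) ?_
    intro y hy
    have hy' : y ∈ Algebra.adjoin K {φ a} := hy
    refine Algebra.adjoin_induction ?_ ?_ ?_ ?_ hy'
    · rintro y rfl
      exact Algebra.subset_adjoin (Or.inl ⟨e.symm ⟨a, has rfl⟩, by simp [hxdef]⟩)
    · exact fun r => Algebra.subset_adjoin (Or.inr ⟨r, rfl⟩)
    · exact fun _ _ _ _ h₁ h₂ => add_mem h₁ h₂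
    · exact fun _ _ _ _ h₁ h₂ => mul_mem h₁ h₂
  obtain ⟨v, hv1, hv2, hv⟩ := exists_isTranscendenceBasis_between (R := k)
    (Set.range (φ ∘ x)) (Set.range (φ ∘ x) ∪ Set.range (RatFunc.C (K := K)))
    Set.subset_union_left (hind.to_subtype_range)
  -- Some `φ (x i)` may itself be constant; removing it keeps the two families disjoint.
  let Z : Set K := {c | RatFunc.C c ∈ v \ Set.range (φ ∘ x)}
  let z : Z → RatFunc K := fun c => RatFunc.C (c : K)
  have hinj : Function.Injective (Sum.elim (φ ∘ x) z) := by
    refine hind.injective.sumElim (RatFunc.C_injective.comp Subtype.val_injective) ?_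
    intro i c h
    exact c.2.2 ⟨i, h⟩
  have hrange : Set.range (Sum.elim (φ ∘ x) z) = v := by
    rw [Set.Sum.elim_range]
    apply Set.Subset.antisymm
    · exact Set.union_subset hv1 (by rintro _ ⟨c, rfl⟩; exact c.2.1)
    · intro y hy
      by_cases hyx : y ∈ Set.range (φ ∘ x)
      · exact Or.inl hyx
      · rcases hv2 hy with h | ⟨c, rfl⟩
        · exact absurd h hyx
        · exact Or.inr ⟨⟨c, hy, hyx⟩, rfl⟩
  have hbasis : IsTranscendenceBasis k (Sum.elim (φ ∘ x) z) := by
    rw [← isTranscendenceBasis_subtype_range hinj, hrange]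
    exact hv
  have hZ : ∀ b ∈ Algebra.adjoin k Z, algebraMap K (RatFunc K) b ∈
      Algebra.adjoin k (Set.range z) := by
    intro b hb
    refine Algebra.adjoin_induction ?_ ?_ ?_ ?_ hb
    · exact fun c hc => Algebra.subset_adjoin ⟨⟨c, hc⟩, rfl⟩
    · intro r
      rw [← IsScalarTower.algebraMap_apply]
      exact Subalgebra.algebraMap_mem _ r
    · intro _ _ _ _ h₁ h₂
      rw [map_add]
      exact add_mem h₁ h₂
    · intro _ _ _ _ h₁ h₂
      rw [map_mul]
      exact mul_mem h₁ h₂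
  obtain ⟨hz, hxz⟩ := AlgebraicIndependent.sumElim_iff.mp hbasis.1
  refine ⟨x, Z, hx, hz.of_comp (IsScalarTower.toAlgHom k K (RatFunc K)), ?_⟩
  have hB : AlgebraicIndependent (Algebra.adjoin k Z) (φ ∘ x) := by
    let f : Algebra.adjoin k Z →+* Algebra.adjoin k (Set.range z) :=
      ((algebraMap K (RatFunc K)).comp (Algebra.adjoin k Z).val.toRingHom).codRestrict _
        fun b => hZ b b.2
    refine AlgebraicIndependent.of_ringHom_of_comp_eq f (RingHom.id (RatFunc K)) hxz ?_ rfl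
    intro b₁ b₂ h
    exact Subtype.ext ((algebraMap K (RatFunc K)).injective
      (congrArg (fun w : Algebra.adjoin k (Set.range z) => (w : RatFunc K)) h))
  rw [isTranscendenceBasis_iff_algebraicIndependent_isAlgebraic]
  refine ⟨hB, ?_⟩
  have := hbasis.isAlgebraic
  refine Algebra.IsAlgebraic.of_subalgebra_subset
    (S₁ := Algebra.adjoin k (Set.range (Sum.elim (φ ∘ x) z))) ?_
  intro y hy
  have hy' : y ∈ Algebra.adjoin k (Set.range (Sum.elim (φ ∘ x) z)) := hy
  refine Algebra.adjoin_induction ?_ ?_ ?_ ?_ hy'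
  · rw [Set.Sum.elim_range]
    rintro y (hy | ⟨c, rfl⟩)
    · exact Algebra.subset_adjoin hy
    · exact Subalgebra.algebraMap_mem (Algebra.adjoin (Algebra.adjoin k Z) _)
        (⟨c, Algebra.subset_adjoin c.2⟩ : Algebra.adjoin k Z)
  · intro r
    exact Subalgebra.algebraMap_mem (Algebra.adjoin (Algebra.adjoin k Z) _)
        (algebraMap k (Algebra.adjoin k Z) r)
  · exact fun _ _ _ _ h₁ h₂ => add_mem h₁ h₂
  · exact fun _ _ _ _ h₁ h₂ => mul_mem h₁ h₂

end TranscendenceBasis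


/-! ### Extending specializations to algebraically closed fields. -/

section Specialization

/-- A homomorphism to an algebraically closed field extends along an injective integral
extension. -/
theorem IsAlgClosed.exists_ringHom_extension_of_isIntegral {P S Ω : Type*} [CommRing P]
    [CommRing S] [Algebra P S] [Algebra.IsIntegral P S]
    (hinj : Function.Injective (algebraMap P S)) [Field Ω] [IsAlgClosed Ω] (π : P →+* Ω) :
    ∃ ψ : S →+* Ω, ψ.comp (algebraMap P S) = π := by
  have : (RingHom.ker π).IsPrime := RingHom.ker_isPrime π
  -- Dividing by a prime over the kernel leaves an algebraic extension of domains and an injection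
  -- into `Ω`, which extends because `Ω` is algebraically closed.
  obtain ⟨Q, -, hQ, hQP⟩ := Ideal.exists_ideal_over_prime_of_isIntegral (S := S) (RingHom.ker π) ⊥
    (by rw [← RingHom.ker_eq_comap_bot, (RingHom.injective_iff_ker_eq_bot _).mp hinj]; exact bot_le)
  have : Q.LiesOver (RingHom.ker π) := ⟨hQP.symm⟩
  let := (RingHom.kerLift π).toAlgebra
  have : FaithfulSMul (P ⧸ RingHom.ker π) Ω :=
    (faithfulSMul_iff_algebraMap_injective _ _).mpr (RingHom.kerLift_injective π)
  have : Algebra.IsIntegral (P ⧸ RingHom.ker π) (S ⧸ Q) := inferInstance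
  have : Algebra.IsAlgebraic (P ⧸ RingHom.ker π) (S ⧸ Q) := inferInstance
  have hQinj : Function.Injective (algebraMap (P ⧸ RingHom.ker π) (S ⧸ Q)) := by
    rw [injective_iff_map_eq_zero]
    intro x
    obtain ⟨p, rfl⟩ := Ideal.Quotient.mk_surjective x
    intro hp
    rw [Ideal.Quotient.algebraMap_mk_of_liesOver, Ideal.Quotient.eq_zero_iff_mem] at hp
    rw [Ideal.Quotient.eq_zero_iff_mem, ← hQP]
    exact hp
  have : FaithfulSMul (P ⧸ RingHom.ker π) (S ⧸ Q) :=
    (faithfulSMul_iff_algebraMap_injective _ _).mpr hQinj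
  have : Module.IsTorsionFree (P ⧸ RingHom.ker π) (S ⧸ Q) :=
    Module.isTorsionFree_iff_faithfulSMul.mpr inferInstance
  let g : (S ⧸ Q) →ₐ[P ⧸ RingHom.ker π] Ω := IsAlgClosed.lift
  refine ⟨g.toRingHom.comp (Ideal.Quotient.mk Q), ?_⟩
  ext p
  exact g.commutes (Ideal.Quotient.mk _ p)

/-- A homomorphism to an algebraically closed field that does not kill `h` extends to a subring
of an extension field containing all elements that are integral after multiplication by `h`. -/
theorem IsAlgClosed.exists_ringHom_extension_subring {P E Ω : Type*} [CommRing P] [IsDomain P]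
    [Field E] [Algebra P E] [FaithfulSMul P E] [Field Ω] [IsAlgClosed Ω] (π : P →+* Ω) {h : P}
    (hh : π h ≠ 0) :
    ∃ (S : Subring E) (hS : ∀ p, algebraMap P E p ∈ S) (ψ : S →+* Ω),
      (∀ p, ψ ⟨algebraMap P E p, hS p⟩ = π p) ∧ ∀ e : E, IsIntegral P (h • e) → e ∈ S := by
  have hne : h ≠ 0 := by rintro rfl; exact hh (map_zero π)
  have hunit : IsUnit (algebraMap P E h) :=
    (((map_ne_zero_iff _ (FaithfulSMul.algebraMap_injective P E)).mpr hne)).isUnit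
  let P' := Localization.Away h
  let i : P' →+* E := IsLocalization.Away.lift h hunit
  have hi : Function.Injective i := by
    refine (IsLocalization.lift_injective_iff (M := Submonoid.powers h) _).mpr ?_
    intro x y
    rw [(IsLocalization.injective P' (powers_le_nonZeroDivisors_of_noZeroDivisors hne)).eq_iff,
      (FaithfulSMul.algebraMap_injective P E).eq_iff]
  let := i.toAlgebra
  have : IsScalarTower P P' E :=
    IsScalarTower.of_algebraMap_eq fun p => (IsLocalization.Away.lift_eq h hunit p).symm
  let S' := integralClosure P' E
  obtain ⟨ψ, hψ⟩ := IsAlgClosed.exists_ringHom_extension_of_isIntegral (P := P') (S := S')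
    (fun x y hxy => hi (congrArg (fun z : S' => (z : E)) hxy))
    (IsLocalization.Away.lift (S := P') h hh.isUnit)
  have hS : ∀ p, algebraMap P E p ∈ S' := fun p => by
    rw [IsScalarTower.algebraMap_apply P P' E]
    exact Subalgebra.algebraMap_mem _ _
  refine ⟨S'.toSubring, hS, ψ, fun p => ?_, fun e he => ?_⟩
  · have h1 := RingHom.congr_fun hψ (algebraMap P P' p)
    rw [IsLocalization.Away.lift_eq] at h1
    rw [← h1]
    refine congrArg ψ (Subtype.ext ?_)
    exact IsScalarTower.algebraMap_apply P P' E p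
  · change IsIntegral P' e
    obtain ⟨u, hu⟩ := IsLocalization.Away.algebraMap_isUnit (S := P') h
    have h1 : IsIntegral P' ((u : P') • e) := by
      rw [hu, algebraMap_smul]
      exact he.tower_top
    have h2 := h1.smul ((u⁻¹ : P'ˣ) : P')
    rwa [smul_smul, Units.inv_mul, one_smul] at h2

/-- A nonzero polynomial over an infinite field extension does not vanish at some point. -/
theorem MvPolynomial.exists_aeval_ne_zero {σ k κ : Type*} [Field k] [Field κ] [Algebra k κ]
    [Infinite κ] {p : MvPolynomial σ k} (hp : p ≠ 0) : ∃ a : σ → κ, MvPolynomial.aeval a p ≠ 0 := by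
  by_contra! h
  apply hp
  apply MvPolynomial.map_injective (algebraMap k κ) (algebraMap k κ).injective
  apply MvPolynomial.funext
  intro a
  rw [MvPolynomial.eval_map, map_zero, map_zero, ← MvPolynomial.aeval_def]
  exact h a

end Specialization


/-! ### Embeddings into the rational functions over a curve. -/

section CurveFamily

/-- A homomorphism that maps a transcendence basis to algebraically independent elements is
injective. -/
theorem AlgHom.injective_of_isTranscendenceBasis {ι k D Ω : Type*} [Field k] [CommRing D]
    [IsDomain D] [Algebra k D] [CommRing Ω] [Algebra k Ω] (χ : D →ₐ[k] Ω) {x : ι → D}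
    (hx : IsTranscendenceBasis k x) (hχ : AlgebraicIndependent k (χ ∘ x)) :
    Function.Injective χ := by
  rw [injective_iff_map_eq_zero]
  intro a ha
  by_contra hne
  have := hx.isAlgebraic
  -- As `D` is algebraic over `k[x]`, a nonzero kernel would contain a nonzero polynomial in `x`.
  have h1 := Ideal.comap_ne_bot_of_algebraic_mem (R := Algebra.adjoin k (Set.range x))
    (I := RingHom.ker χ.toRingHom) hne ha (Algebra.IsAlgebraic.isAlgebraic a)
  obtain ⟨b, hb, hb0⟩ := Submodule.exists_mem_ne_zero_of_ne_bot h1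
  have hb1 : (b : D) ∈ (MvPolynomial.aeval x : MvPolynomial ι k →ₐ[k] D).range := by
    rw [← Algebra.adjoin_range_eq_range_aeval]
    exact b.2
  obtain ⟨p, hp⟩ := hb1
  have hp' : MvPolynomial.aeval x p = (b : D) := hp
  have h2 : MvPolynomial.aeval (χ ∘ x) p = 0 := by
    have h3 : χ (b : D) = 0 := hb
    rw [← hp', MvPolynomial.comp_aeval_apply] at h3
    exact h3
  have h4 : p = 0 := (injective_iff_map_eq_zero _).mp hχ p h2
  apply hb0
  ext
  rw [← hp', h4, map_zero]
  rfl

/-- A transcendence basis can be chosen among the generators, and two distinct members of it would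
form an independent pair. -/
theorem trdeg_adjoin_le_one {k Ω : Type u} [Field k] [Field Ω] [Algebra k Ω] (s : Set Ω)
    (hs : ∀ a ∈ s, ∀ b ∈ s, ¬ AlgebraicIndependent k ![a, b]) :
    Algebra.trdeg k (Algebra.adjoin k s) ≤ 1 := by
  let A := Algebra.adjoin k s
  let s' : Set A := (↑) ⁻¹' s
  have htop : Algebra.adjoin k s' = ⊤ := Algebra.adjoin_adjoin_coe_preimage
  have : Algebra.IsAlgebraic (Algebra.adjoin k s') A := by
    rw [htop]
    exact ⟨fun a => isAlgebraic_algebraMap (⟨a, trivial⟩ : (⊤ : Subalgebra k A))⟩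
  obtain ⟨t, hts, ht⟩ := exists_isTranscendenceBasis_subset (R := k) s'
  rw [← ht.cardinalMk_eq_trdeg, Cardinal.le_one_iff_subsingleton]
  refine ⟨fun a b => ?_⟩
  by_contra hab
  refine hs (a : A) (hts a.2) (b : A) (hts b.2) ?_
  have h1 := ht.1.comp ![a, b] (by
    intro i j
    fin_cases i <;> fin_cases j <;> simp [hab, Ne.symm hab])
  have h2 := h1.map' (f := A.val) Subtype.val_injective
  convert! h2 using 1
  funext i
  fin_cases i <;> rfl

open Polynomial in
/-- A field of transcendence degree two contained in `k(s, τ)`, with the elements of `s`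
pairwise algebraically dependent, embeds into the rational functions over a curve. -/
theorem exists_algHom_fractionRing_polynomial {k F Ω : Type u} [Field k] [Field F] [Field Ω]
    [Algebra k F] [Algebra k Ω] (χ : F →ₐ[k] Ω) (htr : Algebra.trdeg k F = 2) (s : Finset Ω)
    (hs : ∀ a ∈ s, ∀ b ∈ s, ¬ AlgebraicIndependent k ![a, b]) (τ : Ω) (T : Set F)
    (hT : IntermediateField.adjoin k T = ⊤)
    (h : ∀ a ∈ T, ∃ P Q : (Algebra.adjoin k (s : Set Ω))[X],
      aeval τ Q ≠ 0 ∧ χ a * aeval τ Q = aeval τ P) :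
    ∃ (A : Type u) (_ : CommRing A) (_ : IsDomain A) (_ : Algebra k A),
      Algebra.FiniteType k A ∧ ringKrullDim A = 1 ∧ Nonempty (F →ₐ[k] FractionRing A[X]) := by
  let A := Algebra.adjoin k (s : Set Ω)
  have hfin : Algebra.FiniteType k A :=
    A.fg_iff_finiteType.mp (Subalgebra.fg_adjoin_finset s)
  have hle : Algebra.trdeg k A ≤ 1 := trdeg_adjoin_le_one _ hs
  -- If `τ` were algebraic over `A`, all of `χ(F)` would be, and the transcendence degree of `F`
  -- would be at most one.
  have hτ : Transcendental A τ := by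
    intro hτ
    have hmem : ∀ a : F, IsAlgebraic A (χ a) := by
      intro a
      have ha : a ∈ IntermediateField.adjoin k T := by rw [hT]; trivial
      induction ha using IntermediateField.adjoin_induction with
      | mem a ha =>
        obtain ⟨P, Q, hQ, hPQ⟩ := h a ha
        have hp : ∀ P : A[X], IsAlgebraic A (aeval τ P) := fun P =>
          Algebra.adjoin_le (S := Subalgebra.algebraicClosure A Ω)
            (Set.singleton_subset_iff.mpr hτ) (aeval_mem_adjoin_singleton A τ)
        rw [eq_div_of_mul_eq hQ hPQ, div_eq_mul_inv]
        exact (hp P).mul (hp Q).inv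
      | algebraMap r =>
        rw [AlgHom.commutes, IsScalarTower.algebraMap_apply k A Ω]
        exact isAlgebraic_algebraMap _
      | add _ _ _ _ h₁ h₂ => rw [map_add]; exact h₁.add h₂
      | inv _ _ h₁ => rw [map_inv₀]; exact h₁.inv
      | mul _ _ _ _ h₁ h₂ => rw [map_mul]; exact h₁.mul h₂
    let N := Subalgebra.algebraicClosure A Ω
    have : Algebra.IsAlgebraic A N :=
      ⟨fun a => (isAlgebraic_algebraMap_iff (S := N) (A := Ω) Subtype.val_injective).mp a.2⟩
    have : FaithfulSMul A N := (faithfulSMul_iff_algebraMap_injective A N).mpr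
      fun a b hab => Subtype.ext (congrArg (fun z : N => (z : Ω)) hab)
    have h1 := trdeg_add_eq k A (A := N)
    rw [trdeg_eq_zero (R := A), add_zero] at h1
    have h2 := trdeg_le_of_injective (χ.codRestrict (N.restrictScalars k) hmem)
      (by intro a b hab; exact χ.injective (congrArg (fun z : N => (z : Ω)) hab))
    rw [htr] at h2
    have h3 := h2.trans (h1.symm.le.trans hle)
    norm_num at h3
  have hinj : Function.Injective (aeval τ : A[X] →ₐ[A] Ω) := transcendental_iff_injective.mp hτ
  let j : A[X] →ₐ[k] Ω := (aeval τ).restrictScalars k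
  let J : FractionRing A[X] →ₐ[k] Ω := IsFractionRing.liftAlgHom (g := j) hinj
  have hJ : ∀ P, J (algebraMap A[X] _ P) = aeval τ P := fun P =>
    IsFractionRing.lift_algebraMap hinj P
  have hrange : ∀ a : F, χ a ∈ J.range := by
    intro a
    have ha : a ∈ IntermediateField.adjoin k T := by rw [hT]; trivial
    induction ha using IntermediateField.adjoin_induction with
    | mem a ha =>
      obtain ⟨P, Q, hQ, hPQ⟩ := h a ha
      refine ⟨algebraMap A[X] _ P / algebraMap A[X] _ Q, ?_⟩
      rw [eq_div_of_mul_eq hQ hPQ]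
      exact (map_div₀ J _ _).trans (by rw [hJ, hJ])
    | algebraMap r => rw [AlgHom.commutes]; exact Subalgebra.algebraMap_mem _ _
    | add _ _ _ _ h₁ h₂ => rw [map_add]; exact add_mem h₁ h₂
    | inv _ _ h₁ =>
      obtain ⟨y, hy⟩ := h₁
      exact ⟨y⁻¹, by rw [map_inv₀ χ, ← hy]; exact map_inv₀ J y⟩
    | mul _ _ _ _ h₁ h₂ => rw [map_mul]; exact mul_mem h₁ h₂
  let g : F →ₐ[k] FractionRing A[X] :=
    (AlgEquiv.ofInjective J J.injective).symm.toAlgHom.comp (χ.codRestrict J.range hrange)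
  refine ⟨A, inferInstance, inferInstance, inferInstance, hfin, ?_, ⟨g⟩⟩
  -- The embedding forces `2 ≤ trdeg A + 1`, which with `trdeg A ≤ 1` gives dimension exactly one.
  obtain ⟨n, hn1, hn2⟩ := exists_ringKrullDim_eq_and_trdeg_eq k A
  have h1 := trdeg_le_of_injective g g.injective
  rw [trdeg_eq_of_isFractionRing k A[X] (FractionRing A[X]), htr, ← trdeg_add_eq k A,
    Polynomial.trdeg_of_isDomain, hn2] at h1
  rw [hn2] at hle
  have h2 : n = 1 := by
    have h3 : n ≤ 1 := by exact_mod_cast hle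
    have h4 : 2 ≤ n + 1 := by exact_mod_cast h1
    omega
  rw [hn1, h2]
  rfl

end CurveFamily


/-! ### Simultaneous specialization of constants and finitely many field elements. -/

section CurveFamily

/-- The subalgebra is a polynomial ring, and a nonzero polynomial has a nonvanishing point over an
infinite field. -/
theorem AlgebraicIndependent.exists_algHom_apply_ne_zero {ι k K κ : Type*} [Field k] [CommRing K]
    [Algebra k K] [Field κ] [Algebra k κ] [Infinite κ] {x : ι → K} (hx : AlgebraicIndependent k x)
    {c : Algebra.adjoin k (Set.range x)} (hc : c ≠ 0) :
    ∃ π : Algebra.adjoin k (Set.range x) →ₐ[k] κ, π c ≠ 0 := by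
  obtain ⟨a, ha⟩ := MvPolynomial.exists_aeval_ne_zero (κ := κ)
    (p := hx.aevalEquiv.symm c) (by simpa using hc)
  exact ⟨(MvPolynomial.aeval a).comp hx.aevalEquiv.symm.toAlgHom, ha⟩

/-- Specialization of the constants in a field with a transcendence basis of two elements, such
that these two elements stay algebraically independent, finitely many elements of the field can
be specialized, and finitely many polynomials do not vanish. -/
theorem exists_specialization {k B E κ : Type u} [Field k] [CommRing B] [IsDomain B] [Algebra k B]
    [Field E] [Algebra k E] [Algebra B E] [IsScalarTower k B E] [Field κ] [Algebra k κ]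
    {y : Fin 2 → E} (hy : IsTranscendenceBasis B y)
    (hB : ∀ c : B, c ≠ 0 → ∃ π : B →ₐ[k] κ, π c ≠ 0) (es : Finset E)
    (qs : Finset (MvPolynomial (Fin 2) B)) (hqs : ∀ q ∈ qs, q ≠ 0) :
    ∃ (Ω : Type u) (_ : Field Ω) (_ : Algebra k Ω) (_ : Algebra κ Ω) (_ : IsScalarTower k κ Ω)
      (π : B →ₐ[k] κ) (S : Subalgebra k E) (ψ : S →ₐ[k] Ω)
      (hBS : ∀ b, algebraMap B E b ∈ S) (hyS : ∀ i, y i ∈ S),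
      (∀ e ∈ es, e ∈ S) ∧ (∀ b, ψ ⟨algebraMap B E b, hBS b⟩ = algebraMap κ Ω (π b)) ∧
      AlgebraicIndependent κ (fun i => ψ ⟨y i, hyS i⟩) ∧
      ∀ q ∈ qs, MvPolynomial.map π.toRingHom q ≠ 0 := by
  classical
  let P := Algebra.adjoin B (Set.range y)
  let e : MvPolynomial (Fin 2) B ≃ₐ[B] P := hy.1.aevalEquiv
  have halg : Algebra.IsAlgebraic P E := hy.isAlgebraic
  obtain ⟨h, hh, hint⟩ := Algebra.IsAlgebraic.exists_integral_multiples P es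
  have hcoeff : ∀ q : MvPolynomial (Fin 2) B, q ≠ 0 → ∃ m, q.coeff m ≠ 0 := fun q hq =>
    MvPolynomial.ne_zero_iff.mp hq
  choose! m hm using hcoeff
  -- One nonzero coefficient is selected from the common denominator `h` and from each `q`. If `π`
  -- does not kill their product, none of these polynomials specializes to zero.
  obtain ⟨π, hπ⟩ := hB (∏ q ∈ insert (e.symm h) qs, q.coeff (m q)) (by
    rw [Finset.prod_ne_zero_iff]
    intro q hq
    rcases Finset.mem_insert.mp hq with rfl | hq
    · exact hm _ (by simpa using hh)
    · exact hm _ (hqs q hq))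
  rw [map_prod, Finset.prod_ne_zero_iff] at hπ
  have hmap : ∀ q ∈ insert (e.symm h) qs, MvPolynomial.map π.toRingHom q ≠ 0 := by
    intro q hq h0
    apply hπ q hq
    have := congrArg (MvPolynomial.coeff (m q)) h0
    rwa [MvPolynomial.coeff_map, MvPolynomial.coeff_zero] at this
  -- The `y i` are sent to the two variables, so they stay independent; the algebraic closure leaves
  -- room for the elements of `E` that are algebraic over `B[y]`.
  let Ω := AlgebraicClosure (FractionRing (MvPolynomial (Fin 2) κ))
  have hΩ : Function.Injective (algebraMap (MvPolynomial (Fin 2) κ) Ω) := by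
    rw [IsScalarTower.algebraMap_eq (MvPolynomial (Fin 2) κ)
      (FractionRing (MvPolynomial (Fin 2) κ)) Ω, RingHom.coe_comp]
    exact (algebraMap (FractionRing (MvPolynomial (Fin 2) κ)) Ω).injective.comp
      (IsFractionRing.injective _ _)
  let πP : P →+* Ω := ((algebraMap (MvPolynomial (Fin 2) κ) Ω).comp
    (MvPolynomial.map π.toRingHom)).comp e.symm.toRingEquiv.toRingHom
  have hπh : πP h ≠ 0 := by
    intro h0
    exact hmap (e.symm h) (Finset.mem_insert_self _ _)
      ((injective_iff_map_eq_zero _).mp hΩ _ h0)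
  have : FaithfulSMul P E := (faithfulSMul_iff_algebraMap_injective _ _).mpr
    Subtype.val_injective
  obtain ⟨S, hS, ψ, hψ, hSint⟩ := IsAlgClosed.exists_ringHom_extension_subring (E := E) πP hπh
  have hB' : ∀ b, algebraMap B E b ∈ S := fun b => hS (algebraMap B P b)
  have hψB : ∀ b, ψ ⟨algebraMap B E b, hB' b⟩ = algebraMap κ Ω (π b) := by
    intro b
    refine (hψ (algebraMap B P b)).trans ?_
    have h1 : e.symm (algebraMap B P b) = MvPolynomial.C b := e.symm.commutes b
    change algebraMap (MvPolynomial (Fin 2) κ) Ω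
      (MvPolynomial.map π.toRingHom (e.symm (algebraMap B P b))) = _
    rw [h1, MvPolynomial.map_C, IsScalarTower.algebraMap_apply κ (MvPolynomial (Fin 2) κ) Ω]
    rfl
  have hk : ∀ r : k, algebraMap k E r ∈ S := fun r => by
    rw [IsScalarTower.algebraMap_apply k B E]
    exact hB' _
  let S' : Subalgebra k E := { S with algebraMap_mem' := hk }
  let ψ' : S' →ₐ[k] Ω :=
    { ψ with
      commutes' := fun r => by
        have h1 : (algebraMap k S' r : S') = (⟨algebraMap B E (algebraMap k B r), hB' _⟩ : S) :=
          Subtype.ext (IsScalarTower.algebraMap_apply k B E r)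
        change ψ (algebraMap k S' r : S') = _
        rw [h1]
        refine (hψB _).trans ?_
        rw [AlgHom.commutes, ← IsScalarTower.algebraMap_apply] }
  have hyS : ∀ i, y i ∈ S := fun i => hS ⟨y i, Algebra.subset_adjoin ⟨i, rfl⟩⟩
  refine ⟨Ω, inferInstance, inferInstance, inferInstance, inferInstance, π, S', ψ', hB', hyS,
    fun a ha => hSint a (hint a ha), hψB, ?_, fun q hq => hmap q (Finset.mem_insert_of_mem hq)⟩
  have h2 : (fun i => ψ' ⟨y i, hyS i⟩) =
      (IsScalarTower.toAlgHom κ (MvPolynomial (Fin 2) κ) Ω) ∘ MvPolynomial.X := by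
    funext i
    refine (hψ ⟨y i, Algebra.subset_adjoin ⟨i, rfl⟩⟩).trans ?_
    have h1 : e.symm ⟨y i, Algebra.subset_adjoin ⟨i, rfl⟩⟩ = MvPolynomial.X i := by
      rw [AlgEquiv.symm_apply_eq]
      exact Subtype.ext (by
        rw [hy.1.aevalEquiv_apply_coe, MvPolynomial.aeval_X])
    change algebraMap (MvPolynomial (Fin 2) κ) Ω
      (MvPolynomial.map π.toRingHom (e.symm _)) = _
    rw [h1, MvPolynomial.map_X]
    rfl
  rw [h2]
  exact (MvPolynomial.algebraicIndependent_X _ _).map' hΩ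

end CurveFamily


/-! ### Cutting a family of rational curves down to one parameter. -/

section CurveFamily

open Polynomial in
theorem Subalgebra.algebraMap_ratFunc_mem {k K : Type*} [Field k] [Field K] [Algebra k K]
    (G : Subalgebra k (RatFunc K)) (hX : RatFunc.X ∈ G) (p : K[X])
    (hp : ∀ c ∈ p.coeffs, RatFunc.C c ∈ G) : algebraMap K[X] (RatFunc K) p ∈ G := by
  rw [p.as_sum_support_C_mul_X_pow, map_sum]
  refine sum_mem fun i hi => ?_
  rw [map_mul, map_pow, RatFunc.algebraMap_C, RatFunc.algebraMap_X]
  exact mul_mem (hp _ (Polynomial.coeff_mem_coeffs (Polynomial.mem_support_iff.mp hi)))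
    (pow_mem hX i)

/-- Over `B` the field `K(t)` has transcendence degree two, one of which is used by `t`, so only one
is left for `K`. -/
theorem not_algebraicIndependent_pair_ratFunc {B K : Type u} [CommRing B] [IsDomain B] [Field K]
    [Algebra B K] [FaithfulSMul B K] {y : Fin 2 → RatFunc K} (hy : IsTranscendenceBasis B y)
    (a b : K) : ¬ AlgebraicIndependent B ![a, b] := by
  intro h
  have h1 := trdeg_add_eq B K (A := RatFunc K)
  have h2 := hy.lift_cardinalMk_eq_trdeg
  have h3 := h.lift_cardinalMk_le_trdeg
  rw [trdeg_ratFunc] at h1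
  simp only [Cardinal.mk_fin, Cardinal.lift_natCast, Cardinal.lift_id'] at h2 h3
  rw [← h2] at h1
  have h4 : ((2 : ℕ) : Cardinal.{u}) + 1 ≤ ((2 : ℕ) : Cardinal.{u}) := by
    conv_rhs => rw [← h1]
    gcongr
  norm_cast at h4

open Polynomial in
/-- A function field of transcendence degree two that embeds into the rational functions over some
extension field, with not only constant values, embeds into the rational functions over a curve. -/
theorem exists_curve_algHom_of_algHom_ratFunc {k F K : Type u} [Field k] [Field F] [Algebra k F]
    [Field K] [Algebra k K] [Algebra.EssFiniteType k F] (φ : F →ₐ[k] RatFunc K)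
    (htr : Algebra.trdeg k F = 2) (hφ : ∃ a, ¬ ∃ c, φ a = RatFunc.C c) :
    ∃ (A : Type u) (_ : CommRing A) (_ : IsDomain A) (_ : Algebra k A),
      Algebra.FiniteType k A ∧ ringKrullDim A = 1 ∧ Nonempty (F →ₐ[k] FractionRing A[X]) := by
  classical
  obtain ⟨T₀, hT₀⟩ := IntermediateField.fg_top_iff.mpr ‹Algebra.EssFiniteType k F›
  obtain ⟨x, Z, hx, hZ, hy⟩ := exists_isTranscendenceBasis_comp_ratFunc φ htr hφ
  let B := Algebra.adjoin k Z
  -- This field is infinite even if `k` is finite, and it is algebraic over `k`, so algebraic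
  -- independence over `k` persists over it.
  let κ := AlgebraicClosure k
  let E := RatFunc K
  have hB : ∀ c : B, c ≠ 0 → ∃ π : B →ₐ[k] κ, π c ≠ 0 := by
    have h1 := fun c hc => hZ.exists_algHom_apply_ne_zero (κ := κ) (c := c) hc
    rwa [Subtype.range_coe] at h1
  let T : Finset F := T₀ ∪ Finset.univ.image x
  have hT : IntermediateField.adjoin k (T : Set F) = ⊤ := by
    rw [eq_top_iff, ← hT₀]
    exact IntermediateField.adjoin.mono _ _ _ (by simp [T])
  have hxT : ∀ i, x i ∈ T := fun i => by simp [T]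
  let R : Finset K := T.biUnion fun a => (φ a).num.coeffs ∪ (φ a).denom.coeffs
  -- Specializing also the inverses of the denominators keeps the specialized denominators nonzero.
  let es : Finset E := R.image RatFunc.C ∪ {RatFunc.X} ∪
    T.image fun a => (algebraMap K[X] E (φ a).denom)⁻¹
  have hdep : ∀ r : K × K, ∃ q : MvPolynomial (Fin 2) B,
      q ≠ 0 ∧ MvPolynomial.aeval ![r.1, r.2] q = 0 := by
    intro r
    have h1 := not_algebraicIndependent_pair_ratFunc hy r.1 r.2
    rw [algebraicIndependent_iff] at h1
    push Not at h1
    obtain ⟨q, h2, h3⟩ := h1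
    exact ⟨q, h3, h2⟩
  choose q hq0 hq using hdep
  obtain ⟨Ω, _, _, _, _, π, S, ψ, hBS, hyS, hes, hψB, hind, hqs⟩ :=
    exists_specialization hy hB es ((R ×ˢ R).image q) (by
      intro p hp
      obtain ⟨r, -, rfl⟩ := Finset.mem_image.mp hp
      exact hq0 r)
  have hindk : AlgebraicIndependent k (fun i => ψ ⟨φ (x i), hyS i⟩) :=
    hind.restrictScalars (algebraMap k κ).injective
  have hCS : ∀ r ∈ R, RatFunc.C r ∈ S := fun r hr => hes _
    (Finset.mem_union_left _ (Finset.mem_union_left _ (Finset.mem_image_of_mem _ hr)))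
  have hXS : (RatFunc.X : E) ∈ S := hes _ (by simp [es])
  let s : Finset Ω := R.attach.image fun r => ψ ⟨RatFunc.C r.1, hCS r.1 r.2⟩
  let A := Algebra.adjoin k (s : Set Ω)
  let τ : Ω := ψ ⟨RatFunc.X, hXS⟩
  have hs : ∀ a ∈ s, ∀ b ∈ s, ¬ AlgebraicIndependent k ![a, b] := by
    intro a ha b hb hab
    obtain ⟨r₁, -, rfl⟩ := Finset.mem_image.mp ha
    obtain ⟨r₂, -, rfl⟩ := Finset.mem_image.mp hb
    -- Independence over `k` would persist over the algebraic extension `κ`, where it contradicts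
    -- the specialized relation `q`, which is still nonzero.
    have h1 : AlgebraicIndependent κ _ := hab.extendScalars κ
    refine hqs (q (r₁.1, r₂.1)) (Finset.mem_image_of_mem q
      (Finset.mem_product.mpr ⟨r₁.2, r₂.2⟩)) ((injective_iff_map_eq_zero _).mp h1 _ ?_)
    have h2 := hq (r₁.1, r₂.1)
    let jS : B →+* S := ((algebraMap B E).codRestrict S hBS)
    let v : Fin 2 → S := ![⟨RatFunc.C r₁.1, hCS _ r₁.2⟩, ⟨RatFunc.C r₂.1, hCS _ r₂.2⟩]
    have h3 : MvPolynomial.eval₂ jS v (q (r₁.1, r₂.1)) = 0 := by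
      apply Subtype.val_injective
      have h4 := congrArg (algebraMap K E) h2
      rw [map_zero, MvPolynomial.aeval_def, MvPolynomial.hom_eval₂] at h4
      refine (MvPolynomial.hom_eval₂ _ _ S.val.toRingHom _ |>.trans ?_ ).trans h4
      congr 1
      funext i
      fin_cases i <;> rfl
    have h5 := congrArg ψ.toRingHom h3
    rw [map_zero, MvPolynomial.hom_eval₂] at h5
    rw [MvPolynomial.aeval_def, MvPolynomial.eval₂_map, ← h5]
    congr 1
    · ext b
      exact (hψB b).symm
    · funext i
      fin_cases i <;> rfl
  -- The elements of `S` whose specialization is a polynomial in `τ` over `A`. They include `t` and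
  -- the constants in `R`, hence the numerators and denominators of `φ a` for `a ∈ T`.
  let G : Subalgebra k E :=
    (((aeval τ : A[X] →ₐ[A] Ω).range.restrictScalars k).comap ψ).map S.val
  have hCG : ∀ r ∈ R, RatFunc.C r ∈ G := fun r hr =>
    ⟨⟨RatFunc.C r, hCS r hr⟩, ⟨C ⟨ψ ⟨RatFunc.C r, hCS r hr⟩, Algebra.subset_adjoin
      (Finset.mem_image.mpr ⟨⟨r, hr⟩, Finset.mem_attach _ _, rfl⟩)⟩, aeval_C τ _⟩, rfl⟩
  have hXG : (RatFunc.X : E) ∈ G := ⟨⟨RatFunc.X, hXS⟩, ⟨X, aeval_X τ⟩, rfl⟩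
  have hnum : ∀ a ∈ T, algebraMap K[X] E (φ a).num ∈ G := fun a ha =>
    G.algebraMap_ratFunc_mem hXG _ fun c hc => hCG c (Finset.mem_biUnion.mpr
      ⟨a, ha, Finset.mem_union_left _ hc⟩)
  have hdenom : ∀ a ∈ T, algebraMap K[X] E (φ a).denom ∈ G := fun a ha =>
    G.algebraMap_ratFunc_mem hXG _ fun c hc => hCG c (Finset.mem_biUnion.mpr
      ⟨a, ha, Finset.mem_union_right _ hc⟩)
  have hinv : ∀ a ∈ T, (algebraMap K[X] E (φ a).denom)⁻¹ ∈ S := fun a ha =>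
    hes _ (Finset.mem_union_right _ (Finset.mem_image_of_mem _ ha))
  have hd0 : ∀ a, algebraMap K[X] E (φ a).denom ≠ 0 := fun a => by
    simpa using RatFunc.denom_ne_zero (φ a)
  have hGS : ∀ e ∈ G, e ∈ S := by
    rintro _ ⟨e, -, rfl⟩
    exact e.2
  have hφS : ∀ a ∈ T, φ a ∈ S := by
    intro a ha
    rw [← RatFunc.num_div_denom (φ a), div_eq_mul_inv]
    exact mul_mem (hGS _ (hnum a ha)) (hinv a ha)
  let D := Algebra.adjoin k (T : Set F)
  have hDS : ∀ a : D, φ a ∈ S := by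
    have h1 : D ≤ S.comap φ := Algebra.adjoin_le hφS
    exact fun a => h1 a.2
  let χ₀ : D →ₐ[k] Ω := ψ.comp ((φ.comp D.val).codRestrict S hDS)
  have hfrac : IsFractionRing D F := by
    refine IsFractionRing.of_field _ _ fun z => ?_
    have hz : z ∈ IntermediateField.adjoin k (T : Set F) := by rw [hT]; trivial
    obtain ⟨a, ha, b, hb, rfl⟩ := IntermediateField.mem_adjoin_iff_div.mp hz
    exact ⟨⟨a, ha⟩, ⟨b, hb⟩, rfl⟩
  -- Specialization is far from injective on `S`, but it is injective on the image of `D`, since the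
  -- transcendence basis `x` of `F` stays independent.
  have hχ₀ : Function.Injective χ₀ :=
    χ₀.injective_of_isTranscendenceBasis
      (x := fun i => (⟨x i, Algebra.subset_adjoin (hxT i)⟩ : D))
      (IsTranscendenceBasis.of_comp D.val Subtype.val_injective hx) hindk
  let χ : F →ₐ[k] Ω := IsFractionRing.liftAlgHom (g := χ₀) hχ₀
  have hχ : ∀ a (ha : a ∈ T), χ a = ψ ⟨φ a, hφS a ha⟩ := fun a ha =>
    IsFractionRing.lift_algebraMap hχ₀ (⟨a, Algebra.subset_adjoin ha⟩ : D)
  refine exists_algHom_fractionRing_polynomial χ htr s hs τ T hT fun a ha => ?_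
  obtain ⟨n, ⟨P, hP⟩, hn⟩ := hnum a ha
  obtain ⟨d, ⟨Q, hQ⟩, hd⟩ := hdenom a ha
  have hn' : (n : E) = algebraMap K[X] E (φ a).num := hn
  have hd' : (d : E) = algebraMap K[X] E (φ a).denom := hd
  refine ⟨P, Q, ?_, ?_⟩
  · have h1 : d * ⟨_, hinv a ha⟩ = 1 := Subtype.ext (by
      change (d : E) * _ = 1
      rw [hd', mul_inv_cancel₀ (hd0 a)])
    have h2 := congrArg ψ h1
    rw [map_mul, map_one] at h2
    intro h3
    rw [show ψ d = 0 from hQ.symm.trans h3, zero_mul] at h2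
    exact zero_ne_one h2
  · have h1 : (⟨φ a, hφS a ha⟩ : S) * d = n := Subtype.ext (by
      change φ a * (d : E) = n
      rw [hd', hn', ← eq_div_iff (hd0 a), RatFunc.num_div_denom])
    have h2 := congrArg ψ h1
    rw [map_mul] at h2
    rw [hχ a ha, show aeval τ Q = ψ d from hQ, show aeval τ P = ψ n from hP]
    exact h2

end CurveFamily


/-! ### Derivations of field extensions in characteristic zero. -/

section Derivations

open scoped TensorProduct

/-- The extension is a localization followed by a separable algebraic field extension. This is where
characteristic zero enters. -/
theorem Algebra.FormallyEtale.of_isAlgebraic_charZero (A E : Type u) [CommRing A] [IsDomain A]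
    [Field E] [Algebra A E] [FaithfulSMul A E] [CharZero E] [Algebra.IsAlgebraic A E] :
    Algebra.FormallyEtale A E := by
  let L := FractionRing A
  let : Algebra L E := FractionRing.liftAlgebra A E
  have : Algebra.FormallyEtale A L := .of_isLocalization (nonZeroDivisors A)
  have : Algebra.IsAlgebraic L E := (IsFractionRing.comap_isAlgebraic_iff (A := A)).mp ‹_›
  have : CharZero L := (algebraMap L E).charZero_iff (algebraMap L E).injective |>.mpr ‹_›
  have : Algebra.FormallyEtale L E := Algebra.FormallyEtale.of_isSeparable L E
  exact .comp A L E

theorem Derivation.exists_extension_of_formallyEtale {R S T M : Type u} [CommRing R] [CommRing S]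
    [CommRing T] [Algebra R S] [Algebra S T] [Algebra R T] [IsScalarTower R S T]
    [Algebra.FormallyEtale S T] [AddCommGroup M] [Module R M] [Module S M] [Module T M]
    [IsScalarTower R S M] [IsScalarTower R T M] [IsScalarTower S T M] (d : Derivation R S M) :
    ∃ D : Derivation R T M, ∀ a, D (algebraMap S T a) = d a := by
  let e := KaehlerDifferential.tensorKaehlerEquivOfFormallyEtale R S T
  let l : T ⊗[S] Ω[S⁄R] →ₗ[T] M :=
    TensorProduct.AlgebraTensorModule.lift ((LinearMap.toSpanSingleton T (Ω[S⁄R] →ₗ[S] M)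
      d.liftKaehlerDifferential))
  refine ⟨(l ∘ₗ e.symm.toLinearMap).compDer (KaehlerDifferential.D R T), fun a => ?_⟩
  refine (congrArg l (KaehlerDifferential.tensorKaehlerEquivOfFormallyEtale_symm_D_algebraMap
    R S T a)).trans ?_
  simp [l]

/-- The derivation vanishes on `A = R[y]`, so it is `A`-linear, and `Ω[E⁄A] = 0` because `E` is
formally étale over `A`. -/
theorem Derivation.eq_zero_of_isTranscendenceBasis {ι : Type*} {R E M : Type u} [CommRing R]
    [Field E] [CharZero E] [Algebra R E] [AddCommGroup M] [Module R M] [Module E M]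
    [IsScalarTower R E M] {y : ι → E} (hy : IsTranscendenceBasis R y) [IsDomain R]
    (D : Derivation R E M)
    (hD : ∀ i, D (y i) = 0) : D = 0 := by
  let A := Algebra.adjoin R (Set.range y)
  have : Algebra.IsAlgebraic A E := hy.isAlgebraic
  have hA : ∀ a ∈ A, D a = 0 := by
    intro a ha
    induction ha using Algebra.adjoin_induction with
    | mem a ha => obtain ⟨i, rfl⟩ := ha; exact hD i
    | algebraMap r => exact D.map_algebraMap r
    | add a b _ _ h₁ h₂ => rw [map_add, h₁, h₂, add_zero]
    | mul a b _ _ h₁ h₂ => rw [D.leibniz, h₁, h₂, smul_zero, smul_zero, add_zero]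
  let D' : Derivation A E M :=
    { D with
      map_smul' := fun a e => by
        change D (a • e) = a • D e
        rw [Algebra.smul_def, D.leibniz]
        rw [show D (algebraMap A E a) = 0 from hA a a.2, smul_zero, add_zero]
        rfl }
  have := Algebra.FormallyEtale.of_isAlgebraic_charZero A E
  have h0 : D' = 0 := by
    rw [← D'.liftKaehlerDifferential_comp, Subsingleton.elim D'.liftKaehlerDifferential 0]
    ext
    rfl
  ext e
  exact congrArg (fun d : Derivation A E M => d e) h0

/-- On the polynomial ring over a nonempty transcendence basis, the derivation taking every variable
to `1` is nonzero, and it extends along the formally étale extension `K`. -/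
theorem exists_derivation_ne_zero {B K : Type u} [CommRing B] [IsDomain B] [Field K] [CharZero K]
    [Algebra B K] [FaithfulSMul B K] (h : ¬ Algebra.IsAlgebraic B K) :
    ∃ δ : Derivation B K K, δ ≠ 0 := by
  obtain ⟨ι, y, hy⟩ := exists_isTranscendenceBasis' B K
  have hne : Nonempty ι := by
    rw [← not_isEmpty_iff, hy.isEmpty_iff_isAlgebraic]
    exact h
  let P := MvPolynomial ι B
  let : Algebra P K := (MvPolynomial.aeval y).toAlgebra
  have : IsScalarTower B P K := .of_algebraMap_eq fun r => ((MvPolynomial.aeval y).commutes r).symm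
  have : FaithfulSMul P K := (faithfulSMul_iff_algebraMap_injective _ _).mpr hy.1
  have : Algebra.IsAlgebraic P K := by
    have := hy.isAlgebraic
    exact Algebra.IsAlgebraic.of_ringHom_of_comp_eq hy.1.aevalEquiv (RingHom.id K)
      hy.1.aevalEquiv.surjective Function.injective_id
      (RingHom.ext fun p => hy.1.algebraMap_aevalEquiv p)
  have := Algebra.FormallyEtale.of_isAlgebraic_charZero P K
  obtain ⟨D, hD⟩ := Derivation.exists_extension_of_formallyEtale (T := K)
    ((Algebra.linearMap P K).compDer (MvPolynomial.mkDerivation B (fun _ : ι => (1 : P))))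
  refine ⟨D, fun h0 => ?_⟩
  have h1 := hD (MvPolynomial.X hne.some)
  rw [h0] at h1
  refine zero_ne_one (h1.trans ?_)
  change algebraMap P K (MvPolynomial.mkDerivation B (fun _ : ι => (1 : P)) _) = 1
  rw [MvPolynomial.mkDerivation_X, map_one]

open Polynomial in
theorem Derivation.exists_ratFunc_of_polynomial {B K : Type u} [CommRing B] [Field K] [Algebra B K]
    (d : Derivation B K[X] (RatFunc K)) :
    ∃ D : Derivation B (RatFunc K) (RatFunc K), ∀ p, D (algebraMap K[X] _ p) = d p := by
  have : Algebra.FormallyEtale K[X] (RatFunc K) := .of_isLocalization (nonZeroDivisors K[X])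
  exact Derivation.exists_extension_of_formallyEtale d

open Polynomial in
-- On polynomials `δ` acts coefficientwise; the quotient rule extends this to `K(t)`.
theorem Derivation.exists_ratFunc_extension {B K : Type u} [CommRing B] [Field K] [Algebra B K]
    (δ : Derivation B K K) :
    ∃ D : Derivation B (RatFunc K) (RatFunc K),
      (∀ c, D (RatFunc.C c) = RatFunc.C (δ c)) ∧ D RatFunc.X = 0 := by
  let d : Derivation B K[X] K[X] := PolynomialModule.equivPolynomialSelf.compDer δ.mapCoeffs
  obtain ⟨D, hD⟩ := Derivation.exists_ratFunc_of_polynomial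
    ((Algebra.linearMap K[X] (RatFunc K)).compDer d)
  refine ⟨D, fun c => ?_, ?_⟩
  · rw [← RatFunc.algebraMap_C, hD, ← RatFunc.algebraMap_C]
    simp [d]
  · rw [← RatFunc.algebraMap_X, hD]
    simp [d]

open Polynomial in
theorem exists_derivation_ratFunc_X (K : Type u) [Field K] :
    ∃ D : Derivation K (RatFunc K) (RatFunc K), D RatFunc.X = 1 := by
  obtain ⟨D, hD⟩ := Derivation.exists_ratFunc_of_polynomial
    (Polynomial.mkDerivation K (1 : RatFunc K))
  exact ⟨D, by rw [← RatFunc.algebraMap_X, hD, Polynomial.mkDerivation_X]⟩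

end Derivations


/-! ### Valuation rings over an affine chart of the line. -/

section ValuationSubrings

variable {K E : Type*} [Field K] [Field E] [Algebra K E]

theorem Algebra.isPrincipalIdealRing_adjoin_singleton (s : E) :
    IsPrincipalIdealRing (Algebra.adjoin K {s}) := by
  rw [Algebra.adjoin_singleton_eq_range_aeval]
  exact IsPrincipalIdealRing.of_surjective (Polynomial.aeval s : Polynomial K →ₐ[K] E).rangeRestrict
    (AlgHom.rangeRestrict_surjective _)

theorem Algebra.isFractionRing_adjoin (T : Set E) (h : IntermediateField.adjoin K T = ⊤) :
    IsFractionRing (Algebra.adjoin K T) E := by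
  refine IsFractionRing.of_field _ _ fun z => ?_
  have hz : z ∈ IntermediateField.adjoin K T := by rw [h]; trivial
  obtain ⟨a, ha, b, hb, rfl⟩ := IntermediateField.mem_adjoin_iff_div.mp hz
  exact ⟨⟨a, ha⟩, ⟨b, hb⟩, rfl⟩

/-- A valuation ring containing a principal ideal domain with fraction field `E` is closed under
the derivations of `E` that preserve this domain. -/
theorem Derivation.mem_valuationSubring {k : Type*} [CommRing k] [Algebra k E] (R : Subalgebra K E)
    [IsPrincipalIdealRing R] [IsFractionRing R E] (V : ValuationSubring E)
    (hV : ∀ r ∈ R, r ∈ V) (D : Derivation k E E) (hD : ∀ r ∈ R, D r ∈ R) {e : E} (he : e ∈ V) :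
    D e ∈ V := by
  obtain ⟨n, d, hnd, rfl⟩ := IsFractionRing.exists_reduced_fraction (A := R) e
  rw [IsFractionRing.mk'_eq_div] at *
  have hd0 : ((d : R) : E) ≠ 0 := by
    simp
  change (n : E) / ((d : R) : E) ∈ V at he
  change D ((n : E) / ((d : R) : E)) ∈ V
  obtain ⟨u, v, huv⟩ := hnd.isCoprime
  have huv' : (u : E) * n + v * (d : R) = 1 := congrArg (fun r : R => (r : E)) huv
  -- By Bézout, `V` contains the inverse of the reduced denominator of each of its elements, so the
  -- quotient rule stays inside `V`.
  have hinv : ((d : R) : E)⁻¹ ∈ V := by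
    have h1 : ((d : R) : E)⁻¹ = u * (n / (d : R)) + v := by
      field_simp
      rw [← huv', mul_comm (v : E)]
    rw [h1]
    exact add_mem (mul_mem (hV _ u.2) he) (hV _ v.2)
  rw [D.leibniz_div]
  simp only [smul_eq_mul]
  exact mul_mem (pow_mem hinv 2) (sub_mem (mul_mem (hV _ (d : R).2) (hV _ (hD _ n.2)))
    (mul_mem (hV _ n.2) (hV _ (hD _ (d : R).2))))

/-- A principal ideal domain is the intersection of the valuation rings of its height one primes. It
turns regularity at all points of an affine line into being a polynomial. -/
theorem Subalgebra.mem_of_forall_valuationSubring (R : Subalgebra K E)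
    [IsPrincipalIdealRing R] [IsFractionRing R E] {e : E}
    (h : ∀ V : ValuationSubring E, (∀ r ∈ R, r ∈ V) → e ∈ V) : e ∈ R := by
  obtain ⟨a, rfl⟩ := IsDedekindDomain.HeightOneSpectrum.mem_integers_of_valuation_le_one
    (R := R) E e fun v => by
      refine h (v.valuation E).valuationSubring fun r hr => ?_
      exact v.valuation_le_one (⟨r, hr⟩ : R)
  exact a.2

theorem Derivation.mem_adjoin_of_mem {k : Type*} [CommRing k] [Algebra k E] (D : Derivation k E E)
    (s : E) (hs : D s ∈ Algebra.adjoin K {s})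
    (hK : ∀ c, D (algebraMap K E c) ∈ Algebra.adjoin K {s}) {e : E} (he : e ∈ Algebra.adjoin K {s}) :
    D e ∈ Algebra.adjoin K {s} := by
  induction he using Algebra.adjoin_induction with
  | mem a ha => rw [Set.mem_singleton_iff] at ha; rwa [ha]
  | algebraMap r => exact hK r
  | add a b _ _ h₁ h₂ => rw [map_add]; exact add_mem h₁ h₂
  | mul a b ha hb h₁ h₂ =>
    rw [D.leibniz]
    exact add_mem (mul_mem ha h₂) (mul_mem hb h₁)

end ValuationSubrings


/-! ### Evaluating pluricanonical forms on derivations. -/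

noncomputable section

section Pluriforms

open scoped TensorProduct

variable {k F E : Type u} [Field k] [Field F] [Field E] [Algebra k F] [Algebra k E] [Algebra F E]
  [IsScalarTower k F E]

/-- The value of a `2`-form on a pair of derivations of an extension field. -/
def twoFormEval (D : Fin 2 → Derivation k E E) : ⋀[F]^2 (Ω[F⁄k]) →ₗ[F] E :=
  let det : (Fin 2 → E) [⋀^Fin 2]→ₗ[E] E := Matrix.detRowAlternating
  let detF : (Fin 2 → E) [⋀^Fin 2]→ₗ[F] E :=
    { det.toMultilinearMap.restrictScalars F with
      map_eq_zero_of_eq' := det.map_eq_zero_of_eq' }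
  exteriorPower.alternatingMapLinearEquiv
    (detF.compLinearMap
      (LinearMap.pi fun i => ((D i).compAlgebraMap F).liftKaehlerDifferential))

theorem twoFormEval_ιMulti (D : Fin 2 → Derivation k E E) (a b : F) :
    twoFormEval D (exteriorPower.ιMulti F 2
      ![KaehlerDifferential.D k F a, KaehlerDifferential.D k F b]) =
        D 0 (algebraMap F E a) * D 1 (algebraMap F E b) -
          D 1 (algebraMap F E a) * D 0 (algebraMap F E b) := by
  rw [twoFormEval, exteriorPower.alternatingMapLinearEquiv_apply_ιMulti]
  refine (Matrix.det_fin_two (fun i j => ((D j).compAlgebraMap F).liftKaehlerDifferential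
    ((![KaehlerDifferential.D k F a, KaehlerDifferential.D k F b] : Fin 2 → _) i))).trans ?_
  simp

/-- The value of a rational pluricanonical form on a pair of derivations of an extension field. -/
def pluriformEval (D : Fin 2 → Derivation k E E) (m : ℕ) : RationalPluriform k F m →ₗ[F] E :=
  PiTensorProduct.lift
    ((MultilinearMap.mkPiAlgebra F (Fin m) E).compLinearMap fun _ => twoFormEval D)

theorem pluriformEval_tprod (D : Fin 2 → Derivation k E E) {m : ℕ}
    (v : Fin m → ⋀[F]^2 (Ω[F⁄k])) :
    pluriformEval D m (PiTensorProduct.tprod F v) = ∏ j, twoFormEval D (v j) := by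
  simp [pluriformEval]

/-- The generators are products of forms `da ∧ db` with `a, b ∈ O`, whose values involve only
derivatives of elements of `V`. -/
theorem pluriformEval_mem (D : Fin 2 → Derivation k E E) {m : ℕ} {O : Subring F} {V : Subring E}
    (hO : ∀ a ∈ O, algebraMap F E a ∈ V) (hD : ∀ i, ∀ e ∈ V, D i e ∈ V)
    {w : RationalPluriform k F m} (hw : w ∈ regularPluriforms k m O) :
    pluriformEval D m w ∈ V := by
  induction hw using Submodule.span_induction with
  | mem w hw =>
    obtain ⟨a, b, rfl⟩ := hw
    rw [pluriformEval_tprod]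
    refine prod_mem fun j _ => ?_
    rw [twoFormEval_ιMulti]
    have h1 := fun i => hD i _ (hO _ (a j).2)
    have h2 := fun i => hD i _ (hO _ (b j).2)
    exact sub_mem (mul_mem (h1 0) (h2 1)) (mul_mem (h1 1) (h2 0))
  | zero => rw [map_zero]; exact zero_mem _
  | add _ _ _ _ h₁ h₂ => rw [map_add]; exact add_mem h₁ h₂
  | smul r w _ h =>
    have h1 : r • w = (r : F) • w := rfl
    rw [h1, map_smul, Algebra.smul_def]
    exact mul_mem (hO _ r.2) h

/-- The universal derivation modulo the span kills a transcendence basis, so it vanishes. -/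
theorem span_kaehlerDifferential_eq_top [CharZero F] {ι : Type*} {x : ι → F}
    (hx : IsTranscendenceBasis k x) :
    Submodule.span F (Set.range fun i => KaehlerDifferential.D k F (x i)) = ⊤ := by
  set N := Submodule.span F (Set.range fun i => KaehlerDifferential.D k F (x i))
  have h := Derivation.eq_zero_of_isTranscendenceBasis hx
    (N.mkQ.compDer (KaehlerDifferential.D k F)) fun i =>
      (Submodule.Quotient.mk_eq_zero N).mpr (Submodule.subset_span ⟨i, rfl⟩)
  rw [eq_top_iff, ← KaehlerDifferential.span_range_derivation, Submodule.span_le]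
  rintro _ ⟨a, rfl⟩
  exact (Submodule.Quotient.mk_eq_zero N).mp (congrArg (fun d : Derivation k F _ => d a) h)

/-- Expanding multilinearly, repeated indices contribute zero and permuted ones a sign. No basis is
needed, only two generators. -/
theorem exteriorPower.exists_eq_smul_of_span_pair {R M : Type*} [CommRing R] [AddCommGroup M]
    [Module R M] {v : Fin 2 → M} (hv : Submodule.span R (Set.range v) = ⊤) (w : ⋀[R]^2 M) :
    ∃ c : R, w = c • exteriorPower.ιMulti R 2 v := by
  suffices w ∈ Submodule.span R {exteriorPower.ιMulti R 2 v} by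
    obtain ⟨c, hc⟩ := Submodule.mem_span_singleton.mp this
    exact ⟨c, hc.symm⟩
  have hw : w ∈ Submodule.span R (Set.range (exteriorPower.ιMulti R 2 (M := M))) := by
    rw [exteriorPower.ιMulti_span]; trivial
  refine Submodule.span_le.mpr ?_ hw
  rintro _ ⟨u, rfl⟩
  have h1 : ∀ i, ∃ c : Fin 2 → R, ∑ j, c j • v j = u i := fun i => by
    rw [← Submodule.mem_span_range_iff_exists_fun, hv]; trivial
  choose c hc using h1
  rw [← funext hc]
  have h2 := (exteriorPower.ιMulti R 2 (M := M)).toMultilinearMap.map_sum fun i j => c i j • v j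
  change exteriorPower.ιMulti R 2 (fun i => ∑ j, c i j • v j) = _ at h2
  rw [h2]
  refine Submodule.sum_mem _ fun r _ => ?_
  rw [MultilinearMap.map_smul_univ]
  refine Submodule.smul_mem _ _ ?_
  change exteriorPower.ιMulti R 2 (v ∘ r) ∈ _
  by_cases hr : Function.Injective r
  · have h3 := (exteriorPower.ιMulti R 2 (M := M)).map_perm v
      (Equiv.ofBijective r (Finite.injective_iff_bijective.mp hr))
    rw [show v ∘ r = v ∘ Equiv.ofBijective r (Finite.injective_iff_bijective.mp hr) from rfl, h3]
    rw [Units.smul_def]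
    exact zsmul_mem (Submodule.mem_span_singleton_self _) _
  · rw [Function.not_injective_iff] at hr
    obtain ⟨a, b, hab, hne⟩ := hr
    rw [(exteriorPower.ιMulti R 2 (M := M)).map_eq_zero_of_eq (v ∘ r) (congrArg v hab) hne]
    exact zero_mem _

theorem exists_pluriform_eq_smul [CharZero F] {x : Fin 2 → F} (hx : IsTranscendenceBasis k x)
    {m : ℕ} (w : RationalPluriform k F m) :
    ∃ c : F, w = c • PiTensorProduct.tprod F fun _ => exteriorPower.ιMulti F 2
      ![KaehlerDifferential.D k F (x 0), KaehlerDifferential.D k F (x 1)] := by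
  have hw : w ∈ Submodule.span F (Set.range (PiTensorProduct.tprod F)) := by
    rw [PiTensorProduct.span_tprod_eq_top]; trivial
  have hspan : Submodule.span F (Set.range
      ![KaehlerDifferential.D k F (x 0), KaehlerDifferential.D k F (x 1)]) = ⊤ := by
    rw [← span_kaehlerDifferential_eq_top hx]
    congr 2
    funext i
    fin_cases i <;> rfl
  induction hw using Submodule.span_induction with
  | mem w hw =>
    obtain ⟨u, rfl⟩ := hw
    choose c hc using fun j => exteriorPower.exists_eq_smul_of_span_pair hspan (u j)
    refine ⟨∏ j, c j, ?_⟩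
    rw [← MultilinearMap.map_smul_univ]
    congr 1
    funext j
    exact hc j
  | zero => exact ⟨0, by simp⟩
  | add _ _ _ _ h₁ h₂ =>
    obtain ⟨a, rfl⟩ := h₁
    obtain ⟨b, rfl⟩ := h₂
    exact ⟨a + b, (add_smul _ _ _).symm⟩
  | smul r w _ h =>
    obtain ⟨a, rfl⟩ := h
    exact ⟨r * a, (mul_smul _ _ _).symm⟩

end Pluriforms

end


/-! ### Vanishing of pluricanonical forms along a rational curve. -/

section Pluriforms

open Polynomial in
-- This is the vanishing of the global sections of `𝒪(-n)` on `ℙ¹`, by comparing degrees after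
-- clearing powers of `1/t`.
theorem RatFunc.eq_zero_of_mem_adjoin {K : Type*} [Field K] {a : RatFunc K} {n : ℕ} (hn : 0 < n)
    (h : a ∈ Algebra.adjoin K {(RatFunc.X : RatFunc K)})
    (h' : RatFunc.X ^ n * a ∈ Algebra.adjoin K {(RatFunc.X : RatFunc K)⁻¹}) : a = 0 := by
  rw [Algebra.adjoin_singleton_eq_range_aeval] at h h'
  obtain ⟨p, rfl⟩ := h
  obtain ⟨q, hq⟩ := h'
  have hX : ∀ p : K[X], aeval (RatFunc.X : RatFunc K) p =
      algebraMap K[X] (RatFunc K) p := fun p => by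
    rw [← RatFunc.algebraMap_X, aeval_algebraMap_apply, aeval_X_left_apply]
  have hX0 : (RatFunc.X : RatFunc K) ≠ 0 := RatFunc.X_ne_zero
  have h1 : aeval (RatFunc.X : RatFunc K)⁻¹ q * RatFunc.X ^ q.natDegree =
      aeval RatFunc.X q.reverse := by
    let : Invertible (RatFunc.X : RatFunc K)⁻¹ := invertibleOfNonzero (inv_ne_zero hX0)
    have h2 := eval₂_reverse_mul_pow (algebraMap K (RatFunc K)) (RatFunc.X : RatFunc K)⁻¹ q
    rw [invOf_eq_inv, inv_inv] at h2
    rw [aeval_def, aeval_def, ← h2, mul_assoc, ← mul_pow, inv_mul_cancel₀ hX0, one_pow, mul_one]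
  have h2 : Polynomial.X ^ (n + q.natDegree) * p = q.reverse := by
    apply RatFunc.algebraMap_injective K
    rw [← hX, ← hX, ← h1, show aeval (RatFunc.X : RatFunc K)⁻¹ q = _ from hq]
    simp only [map_mul, map_pow, aeval_X]
    change _ = RatFunc.X ^ n * aeval RatFunc.X p * _
    ring
  change aeval RatFunc.X p = 0
  by_cases hp : p = 0
  · rw [hp, map_zero]
  · have h3 := congrArg natDegree h2
    rw [natDegree_mul (pow_ne_zero _ Polynomial.X_ne_zero) hp, natDegree_pow, natDegree_X,
      mul_one] at h3
    have h4 := q.reverse_natDegree_le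
    omega

variable {k F K : Type u} [Field k] [Field F] [Algebra k F] [Field K] [Algebra k K]

/-- For a transcendence basis of two elements of `K(t)` over a ring of constants `B`, there are a
derivation of `K(t)` extending one of `K`, and the derivation `d/dt`, with nonzero Jacobian. -/
theorem exists_derivation_pair {k B K : Type u} [CommRing k] [CommRing B] [IsDomain B] [Field K]
    [Algebra k B] [Algebra k K] [Algebra B K] [IsScalarTower k B K] [FaithfulSMul B K] [CharZero K]
    {y : Fin 2 → RatFunc K} (hy : IsTranscendenceBasis B y) :
    ∃ D : Fin 2 → Derivation k (RatFunc K) (RatFunc K),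
      (∀ c, ∃ c', D 0 (RatFunc.C c) = RatFunc.C c') ∧ D 0 RatFunc.X = 0 ∧
      (∀ c, D 1 (RatFunc.C c) = 0) ∧ D 1 RatFunc.X = 1 ∧
      D 0 (y 0) * D 1 (y 1) - D 1 (y 0) * D 0 (y 1) ≠ 0 := by
  have : CharZero (RatFunc K) := charZero_of_injective_algebraMap (algebraMap K _).injective
  have hnot : ¬ Algebra.IsAlgebraic B K := by
    intro _
    have h1 := trdeg_add_eq B K (A := RatFunc K)
    have h2 := hy.lift_cardinalMk_eq_trdeg
    rw [trdeg_ratFunc, trdeg_eq_zero (R := B)] at h1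
    simp only [Cardinal.mk_fin, Cardinal.lift_natCast, Cardinal.lift_id'] at h2
    rw [← h2] at h1
    norm_num at h1
  obtain ⟨δ, hδ⟩ := exists_derivation_ne_zero hnot
  obtain ⟨D₁, hD₁, hD₁X⟩ := δ.exists_ratFunc_extension
  obtain ⟨D₂, hD₂X⟩ := exists_derivation_ratFunc_X K
  refine ⟨![D₁.restrictScalars k, D₂.restrictScalars k], fun c => ⟨_, hD₁ c⟩, hD₁X,
    fun c => D₂.map_algebraMap c, hD₂X, fun hJ => ?_⟩
  have hJ' : D₁ (y 0) * D₂ (y 1) - D₂ (y 0) * D₁ (y 1) = 0 := hJ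
  -- If the Jacobian vanished, these combinations would kill both `y j` and so be zero. Evaluated at
  -- a constant with `δ c ≠ 0` they give `D₂ (y i) = 0`, hence `D₂ = 0`, against `D₂ t = 1`.
  have h0 : ∀ i, D₂ (y i) • D₁ - D₁ (y i) • D₂.restrictScalars B = 0 := by
    intro i
    apply Derivation.eq_zero_of_isTranscendenceBasis hy
    intro j
    change D₂ (y i) * D₁ (y j) - D₁ (y i) * D₂ (y j) = 0
    fin_cases i <;> fin_cases j
    · exact sub_eq_zero.mpr (mul_comm _ _)
    · exact (by linear_combination -hJ' : D₂ (y 0) * D₁ (y 1) - D₁ (y 0) * D₂ (y 1) = 0)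
    · exact (by linear_combination hJ' : D₂ (y 1) * D₁ (y 0) - D₁ (y 1) * D₂ (y 0) = 0)
    · exact sub_eq_zero.mpr (mul_comm _ _)
  obtain ⟨c, hc⟩ : ∃ c, δ c ≠ 0 := by
    by_contra! h
    exact hδ (Derivation.ext h)
  have h1 : ∀ i, D₂ (y i) = 0 := by
    intro i
    have h2 := congrArg (fun d : Derivation B (RatFunc K) (RatFunc K) => d (RatFunc.C c)) (h0 i)
    change D₂ (y i) * D₁ (RatFunc.C c) - D₁ (y i) * D₂ (RatFunc.C c) = 0 at h2
    rw [show D₂ (RatFunc.C c) = 0 from D₂.map_algebraMap c, mul_zero, sub_zero, hD₁] at h2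
    refine (mul_eq_zero.mp h2).resolve_right ?_
    exact (map_ne_zero _).mpr hc
  have h2 : D₂.restrictScalars B = 0 := Derivation.eq_zero_of_isTranscendenceBasis hy _ h1
  have h3 := congrArg (fun d : Derivation B (RatFunc K) (RatFunc K) => d RatFunc.X) h2
  exact zero_ne_one (h3.symm.trans hD₂X)

/-- A pluricanonical form that is regular along all valuation rings of `K(t)` over `K` vanishes. -/
theorem pluriform_eq_zero_of_forall_valuationSubring [CharZero k] (φ : F →ₐ[k] RatFunc K)
    (htr : Algebra.trdeg k F = 2) (hφ : ∃ a, ¬ ∃ c, φ a = RatFunc.C c) {m : ℕ} (hm : 0 < m)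
    (w : RationalPluriform k F m)
    (hw : ∀ V : ValuationSubring (RatFunc K), (∀ c : K, RatFunc.C c ∈ V) →
      ∃ O : Subring F, (∀ a ∈ O, φ a ∈ V) ∧ w ∈ regularPluriforms k m O) : w = 0 := by
  obtain ⟨x, Z, hx, -, hy⟩ := exists_isTranscendenceBasis_comp_ratFunc φ htr hφ
  have : CharZero K := charZero_of_injective_algebraMap (algebraMap k K).injective
  obtain ⟨D, hD0C, hD0X, hD1C, hD1X, hJ⟩ := exists_derivation_pair (k := k) hy
  have : CharZero F := charZero_of_injective_algebraMap (algebraMap k F).injective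
  let : Algebra F (RatFunc K) := φ.toRingHom.toAlgebra
  have : IsScalarTower k F (RatFunc K) := .of_algebraMap_eq fun r => (φ.commutes r).symm
  obtain ⟨c, rfl⟩ := exists_pluriform_eq_smul hx w
  -- Stated for any generator `s` of `K(t)`, to be used on both charts, with `s = t` and `s = 1/t`.
  have hmem : ∀ (s : RatFunc K) (D : Fin 2 → Derivation k (RatFunc K) (RatFunc K)),
      IntermediateField.adjoin K {s} = ⊤ →
      (∀ i, D i s ∈ Algebra.adjoin K {s}) →
      (∀ i c, D i (RatFunc.C c) ∈ Algebra.adjoin K {s}) →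
      pluriformEval D m (c • PiTensorProduct.tprod F fun _ => exteriorPower.ιMulti F 2
        ![KaehlerDifferential.D k F (x 0), KaehlerDifferential.D k F (x 1)]) ∈
          Algebra.adjoin K {s} := by
    intro s D hs hDs hDC
    have := Algebra.isPrincipalIdealRing_adjoin_singleton (K := K) s
    have := Algebra.isFractionRing_adjoin (K := K) {s} hs
    refine Subalgebra.mem_of_forall_valuationSubring _ fun V hV => ?_
    obtain ⟨O, hO, hwO⟩ := hw V fun c => hV _ (Subalgebra.algebraMap_mem _ c)
    exact pluriformEval_mem (V := V.toSubring) D hO (fun i e he =>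
      Derivation.mem_valuationSubring (Algebra.adjoin K {s}) V hV (D i)
        (fun r hr => (D i).mem_adjoin_of_mem s (hDs i) (hDC i) hr) he) hwO
  set a := algebraMap F (RatFunc K) c *
    (D 0 (φ (x 0)) * D 1 (φ (x 1)) - D 1 (φ (x 0)) * D 0 (φ (x 1))) ^ m with ha
  have hX0 : (RatFunc.X : RatFunc K) ≠ 0 := RatFunc.X_ne_zero
  have h1 : a ∈ Algebra.adjoin K {(RatFunc.X : RatFunc K)} := by
    have h := hmem RatFunc.X D RatFunc.adjoin_X ?_ ?_
    · rw [map_smul, pluriformEval_tprod, twoFormEval_ιMulti, Finset.prod_const, Finset.card_univ,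
        Fintype.card_fin, Algebra.smul_def] at h
      exact h
    · intro i
      fin_cases i
      · exact hD0X ▸ zero_mem _
      · exact hD1X ▸ one_mem _
    · intro i c
      fin_cases i
      · obtain ⟨c', h⟩ := hD0C c
        exact h ▸ Subalgebra.algebraMap_mem _ c'
      · exact hD1C c ▸ zero_mem _
  -- With `u = 1/t` one has `t² d/dt = -d/du`, which preserves `K[u]`. Each of the `m` factors of
  -- the form picks up one `t²`.
  have h2 : RatFunc.X ^ (2 * m) * a ∈ Algebra.adjoin K {(RatFunc.X : RatFunc K)⁻¹} := by
    have h := hmem RatFunc.X⁻¹ ![D 0, (RatFunc.X ^ 2 : RatFunc K) • D 1] ?_ ?_ ?_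
    · rw [map_smul, pluriformEval_tprod, twoFormEval_ιMulti, Finset.prod_const, Finset.card_univ,
        Fintype.card_fin, Algebra.smul_def] at h
      refine (congrArg (· ∈ Algebra.adjoin K {(RatFunc.X : RatFunc K)⁻¹}) ?_).mp h
      change algebraMap F (RatFunc K) c * (D 0 (φ (x 0)) * (RatFunc.X ^ 2 * D 1 (φ (x 1))) -
        RatFunc.X ^ 2 * D 1 (φ (x 0)) * D 0 (φ (x 1))) ^ m = _
      rw [ha, pow_mul, mul_left_comm (((RatFunc.X : RatFunc K) ^ 2) ^ m)]
      congr 1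
      rw [← mul_pow]
      congr 1
      ring
    · rw [eq_top_iff, ← RatFunc.adjoin_X, IntermediateField.adjoin_simple_le_iff]
      exact inv_mem_iff.mp (IntermediateField.mem_adjoin_simple_self K _)
    · intro i
      fin_cases i
      · change D 0 RatFunc.X⁻¹ ∈ _
        rw [Derivation.leibniz_inv, hD0X, smul_zero]
        exact zero_mem _
      · change RatFunc.X ^ 2 * D 1 RatFunc.X⁻¹ ∈ _
        rw [Derivation.leibniz_inv, hD1X]
        have h3 : RatFunc.X ^ 2 * (-(RatFunc.X : RatFunc K)⁻¹ ^ 2 • (1 : RatFunc K)) = -1 := by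
          simp only [smul_eq_mul]
          field_simp
        rw [h3]
        exact neg_mem (one_mem _)
    · intro i c
      fin_cases i
      · obtain ⟨c', h⟩ := hD0C c
        exact h ▸ Subalgebra.algebraMap_mem _ c'
      · change RatFunc.X ^ 2 * D 1 (RatFunc.C c) ∈ _
        rw [hD1C c, mul_zero]
        exact zero_mem _
  have h3 : a = 0 := RatFunc.eq_zero_of_mem_adjoin (by omega) h1 h2
  have h4 : c = 0 := by
    rw [ha, mul_eq_zero] at h3
    exact (map_eq_zero _).mp (h3.resolve_right (pow_ne_zero _ hJ))
  rw [h4, zero_smul]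

end Pluriforms



/-! ### The affine chart `x₀ ≠ 0` of the projective line. -/

noncomputable section

attribute [local instance] MvPolynomial.gradedAlgebra

section Chart

/-- Applied with `s = x₀` and `v = (1, x₁/x₀)`, this is dehomogenization. -/
theorem MvPolynomial.IsHomogeneous.aeval_mul_left {σ R S : Type*} [CommRing R] [CommRing S]
    [Algebra R S] [Fintype σ]
    {p : MvPolynomial σ R} {n : ℕ} (hp : p.IsHomogeneous n) (s : S) (v : σ → S) :
    MvPolynomial.aeval (fun i => s * v i) p = s ^ n * MvPolynomial.aeval v p := by
  rw [MvPolynomial.aeval_def, MvPolynomial.aeval_def, MvPolynomial.eval₂_eq',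
    MvPolynomial.eval₂_eq', Finset.mul_sum]
  refine Finset.sum_congr rfl fun d hd => ?_
  have h1 := hp (MvPolynomial.mem_support_iff.mp hd)
  have h2 : ∑ i, d i = n := by
    rw [← h1]
    simp [Finsupp.weight_apply, Finsupp.sum_fintype]
  simp_rw [mul_pow, Finset.prod_mul_distrib, Finset.prod_pow_eq_pow_sum, h2]
  ring

variable (k : Type u) [Field k]

/-- The coordinate ring of the chart `x₀ ≠ 0` of the projective line. -/
abbrev projLineAway : Type u :=
  HomogeneousLocalization.Away (MvPolynomial.homogeneousSubmodule (Fin (1 + 1)) k)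
    (MvPolynomial.X 0)

/-- The ring `k[x₀, x₁][1 / x₀]`. -/
abbrev projLineLoc : Type u := Localization.Away (MvPolynomial.X 0 : MvPolynomial (Fin (1 + 1)) k)

/-- The inclusion of the constants into the coordinate ring of the chart `x₀ ≠ 0`. -/
def projLineAwayC : k →+* projLineAway k :=
  (algebraMap (MvPolynomial.homogeneousSubmodule (Fin (1 + 1)) k 0) (projLineAway k)).comp
    (algebraMap k (MvPolynomial.homogeneousSubmodule (Fin (1 + 1)) k 0))

theorem MvPolynomial.X_mem_homogeneousSubmodule_one (i : Fin (1 + 1)) :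
    (MvPolynomial.X i : MvPolynomial (Fin (1 + 1)) k) ∈
      MvPolynomial.homogeneousSubmodule (Fin (1 + 1)) k 1 :=
  MvPolynomial.isHomogeneous_X k i

/-- The map from `k[t]` to the coordinate ring of the chart `x₀ ≠ 0`, with `t ↦ x₁ / x₀`. -/
def polynomialToProjLineAway : Polynomial k →+* projLineAway k :=
  Polynomial.eval₂RingHom (projLineAwayC k)
    (HomogeneousLocalization.Away.mk _ (MvPolynomial.X_mem_homogeneousSubmodule_one k 0) 1
      (MvPolynomial.X 1) (by simpa using MvPolynomial.X_mem_homogeneousSubmodule_one k 1))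

/-- The ratio `x₁ / x₀` of the coordinates of the projective line. -/
def projLineRatio : projLineLoc k :=
  Localization.mk (MvPolynomial.X 1) ⟨MvPolynomial.X 0 ^ 1, 1, rfl⟩

theorem val_polynomialToProjLineAway (p : Polynomial k) :
    (polynomialToProjLineAway k p).val = Polynomial.aeval (projLineRatio k) p := by
  have h : (algebraMap (projLineAway k) (projLineLoc k)).comp (polynomialToProjLineAway k) =
      (Polynomial.aeval (projLineRatio k) : Polynomial k →ₐ[k] _).toRingHom := by
    apply Polynomial.ringHom_ext
    · intro a
      simp only [polynomialToProjLineAway, projLineAwayC, RingHom.comp_apply,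
        Polynomial.coe_eval₂RingHom, Polynomial.eval₂_C, ← IsScalarTower.algebraMap_apply]
      refine Eq.trans ?_ (Polynomial.aeval_C _ _).symm
      rfl
    · simp [polynomialToProjLineAway, projLineRatio]
  exact congrArg (fun f : Polynomial k →+* _ => f p) h

theorem algebraMap_mul_projLineRatio :
    algebraMap (MvPolynomial (Fin (1 + 1)) k) (projLineLoc k) (MvPolynomial.X 0) *
      projLineRatio k = algebraMap (MvPolynomial (Fin (1 + 1)) k) (projLineLoc k) (MvPolynomial.X 1) := by
  rw [projLineRatio, Localization.mk_eq_mk', mul_comm]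
  refine Eq.trans ?_ (IsLocalization.mk'_spec (projLineLoc k) (MvPolynomial.X 1)
    (⟨MvPolynomial.X 0 ^ 1, 1, rfl⟩ :
      Submonoid.powers (MvPolynomial.X 0 : MvPolynomial (Fin (1 + 1)) k)))
  exact congrArg (fun x => _ * algebraMap (MvPolynomial (Fin (1 + 1)) k) (projLineLoc k) x)
    (pow_one _).symm

theorem polynomialToProjLineAway_surjective :
    Function.Surjective (polynomialToProjLineAway k) := by
  intro z
  obtain ⟨n, x, hx, rfl⟩ := HomogeneousLocalization.Away.mk_surjective _
    (MvPolynomial.X_mem_homogeneousSubmodule_one k 0) z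
  refine ⟨MvPolynomial.aeval ![1, Polynomial.X] x, ?_⟩
  apply HomogeneousLocalization.val_injective
  rw [val_polynomialToProjLineAway, HomogeneousLocalization.Away.val_mk, Localization.mk_eq_mk',
    IsLocalization.eq_mk'_iff_mul_eq, MvPolynomial.comp_aeval_apply, mul_comm]
  have hx' : x.IsHomogeneous n := by simpa using hx
  change algebraMap _ _ (MvPolynomial.X 0 ^ n) * _ = _
  rw [map_pow, ← hx'.aeval_mul_left]
  have h1 : (fun i => algebraMap (MvPolynomial (Fin (1 + 1)) k) (projLineLoc k) (MvPolynomial.X 0) *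
      Polynomial.aeval (projLineRatio k) ((![1, Polynomial.X] : Fin (1 + 1) → Polynomial k) i)) =
      fun i => algebraMap (MvPolynomial (Fin (1 + 1)) k) _ (MvPolynomial.X i) := by
    funext i
    fin_cases i
    · simp
    · simpa using algebraMap_mul_projLineRatio k
  rw [h1]
  refine (MvPolynomial.aeval_algebraMap_apply (projLineLoc k) MvPolynomial.X x).trans ?_
  rw [MvPolynomial.aeval_X_left_apply]

theorem polynomialToProjLineAway_injective :
    Function.Injective (polynomialToProjLineAway k) := by
  rw [injective_iff_map_eq_zero]
  intro p hp
  have h1 := val_polynomialToProjLineAway k p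
  rw [hp, HomogeneousLocalization.val_zero] at h1
  -- Setting `x₀ = 1` and `x₁ = t` gives a left inverse.
  let f : projLineLoc k →ₐ[k] Polynomial k :=
    IsLocalization.liftAlgHom
      (M := Submonoid.powers (MvPolynomial.X 0 : MvPolynomial (Fin (1 + 1)) k))
      (f := MvPolynomial.aeval ![1, Polynomial.X])
      (by rintro ⟨_, n, rfl⟩; simp)
  have hf : ∀ x, f (algebraMap _ _ x) = MvPolynomial.aeval ![1, Polynomial.X] x := fun x =>
    IsLocalization.lift_eq _ _
  have h2 := congrArg f h1
  have h3 : f (projLineRatio k) = Polynomial.X := by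
    have h4 := congrArg f (algebraMap_mul_projLineRatio k)
    rw [map_mul, hf, hf] at h4
    simpa using h4
  rw [map_zero, ← Polynomial.aeval_algHom_apply, h3, Polynomial.aeval_X_left_apply] at h2
  exact h2.symm

/-- The coordinate ring of the chart `x₀ ≠ 0` is a polynomial ring. -/
def projLineEquiv : projLineAway k ≃+* Polynomial k :=
  (RingEquiv.ofBijective (polynomialToProjLineAway k) ⟨polynomialToProjLineAway_injective k,
    polynomialToProjLineAway_surjective k⟩).symm

theorem projLineEquiv_projLineAwayC (a : k) : projLineEquiv k (projLineAwayC k a) = Polynomial.C a := by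
  rw [projLineEquiv, RingEquiv.symm_apply_eq]
  simp [polynomialToProjLineAway]

/-- The chart `x₀ ≠ 0` of the projective line, as a morphism to `Proj`. -/
def projLineChartProj : Spec (CommRingCat.of (Polynomial k)) ⟶
    Proj (MvPolynomial.homogeneousSubmodule (Fin (1 + 1)) k) :=
  Spec.map (projLineEquiv k).toCommRingCatIso.hom ≫
    Proj.awayι _ _ (MvPolynomial.X_mem_homogeneousSubmodule_one k 0) one_pos

instance : IsOpenImmersion (projLineChartProj k) := by
  unfold projLineChartProj
  infer_instance

theorem projLineChartProj_comp :
    projLineChartProj k ≫ Proj.toSpecZero _ ≫ Spec.map (CommRingCat.ofHom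
      (algebraMap k (MvPolynomial.homogeneousSubmodule (Fin (1 + 1)) k 0))) =
        Spec.map (CommRingCat.ofHom Polynomial.C) := by
  unfold projLineChartProj
  rw [Category.assoc, Proj.awayι_toSpecZero_assoc, ← Spec.map_comp, ← Spec.map_comp]
  congr 1
  apply CommRingCat.hom_ext
  apply RingHom.ext
  exact projLineEquiv_projLineAwayC k

/-- The chart `x₀ ≠ 0` of the projective line. -/
def projLineChart : Spec (CommRingCat.of (Polynomial k)) ⟶ projSpace 1 k :=
  projLineChartProj k

instance : IsOpenImmersion (projLineChart k) :=
  inferInstanceAs (IsOpenImmersion (projLineChartProj k))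

theorem projLineChart_comp_str :
    projLineChart k ≫ projSpaceStr 1 k = Spec.map (CommRingCat.ofHom Polynomial.C) :=
  projLineChartProj_comp k

/-- The zero ideal is a relevant homogeneous prime, and it lies both in the chart and in every
nonempty basic open set. -/
instance : IsDominant (projLineChartProj k) := by
  have h0 : (MvPolynomial.X 0 : MvPolynomial (Fin (1 + 1)) k) ≠ 0 := MvPolynomial.X_ne_zero 0
  let 𝒜 := MvPolynomial.homogeneousSubmodule (Fin (1 + 1)) k
  have hrange : Set.range (projLineChartProj k) =
      (ProjectiveSpectrum.basicOpen 𝒜 (MvPolynomial.X 0) : Set (ProjectiveSpectrum 𝒜)) := by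
    have h1 := (Scheme.Hom.opensRange_comp_of_isIso (Spec.map (projLineEquiv k).toCommRingCatIso.hom)
      (Proj.awayι _ _ (MvPolynomial.X_mem_homogeneousSubmodule_one k 0) one_pos)).trans
        (Proj.opensRange_awayι _ _ _ _)
    exact congrArg (fun U : (Proj 𝒜).Opens => (U : Set (Proj 𝒜))) h1
  constructor
  rw [DenseRange, hrange]
  let η : ProjectiveSpectrum 𝒜 := ⟨⊥, Ideal.isPrime_bot, fun h => h0 (h
    (HomogeneousIdeal.mem_irrelevant_of_mem 𝒜 one_pos
      (MvPolynomial.X_mem_homogeneousSubmodule_one k 0)))⟩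
  refine (ProjectiveSpectrum.isTopologicalBasis_basic_opens 𝒜).dense_iff.mpr ?_
  rintro _ ⟨r, rfl⟩ ⟨x, hx⟩
  refine ⟨η, fun hr => hx ?_, h0⟩
  have hr0 : r = 0 := hr
  rw [hr0]
  exact zero_mem _

instance : IsDominant (projLineChart k) :=
  inferInstanceAs (IsDominant (projLineChartProj k))

end Chart
end



/-! ### Points of transcendence degree two are generic. -/

noncomputable section

attribute [local instance] MvPolynomial.gradedAlgebra

section Dimension

/-- The image of `f` has fraction field `L`, hence dimension two. A nonzero element of the kernel
would make the dimension of `R` at least three. -/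
theorem injective_and_trdeg_eq_two_of_ringKrullDim_le {k R L : Type u} [Field k] [CommRing R]
    [IsDomain R] [Algebra k R] [Algebra.FiniteType k R] [Field L] [Algebra k L] (f : R →ₐ[k] L)
    (hf : ∀ z, ∃ a b, z = f a / f b) (hL : Algebra.trdeg k L = 2) (hR : ringKrullDim R ≤ 2) :
    Function.Injective f ∧ Algebra.trdeg k R = 2 := by
  have : IsFractionRing f.range L := IsFractionRing.of_field _ _ fun z => by
    obtain ⟨a, b, rfl⟩ := hf z
    exact ⟨⟨f a, a, rfl⟩, ⟨f b, b, rfl⟩, rfl⟩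
  have h1 : Algebra.trdeg k f.range = 2 := by
    rw [← trdeg_eq_of_isFractionRing k f.range L, hL]
  have : Algebra.FiniteType k f.range :=
    Algebra.FiniteType.of_surjective f.rangeRestrict f.rangeRestrict_surjective
  have hinj : Function.Injective f := by
    obtain ⟨n, h2, h3⟩ := exists_ringKrullDim_eq_and_trdeg_eq k f.range
    rw [h1] at h3
    have hn : n = 2 := by exact_mod_cast h3.symm
    subst hn
    rw [injective_iff_map_eq_zero]
    intro r hr
    by_contra hr0
    have h4 := ringKrullDim_quotient_succ_le_of_nonZeroDivisor
      (mem_nonZeroDivisors_of_ne_zero hr0)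
    let g : R ⧸ Ideal.span {r} →+* f.range := Ideal.Quotient.lift _ f.rangeRestrict.toRingHom
      fun a ha => by
        obtain ⟨b, rfl⟩ := Ideal.mem_span_singleton'.mp ha
        apply Subtype.ext
        change f (b * r) = 0
        rw [map_mul, hr, mul_zero]
    have h5 := ringKrullDim_le_of_surjective g (Ideal.Quotient.lift_surjective_of_surjective _ _
      f.rangeRestrict_surjective)
    rw [h2] at h5
    have h6 := (add_le_add_left h5 1).trans (h4.trans hR)
    exact absurd h6 (by decide)
  refine ⟨hinj, ?_⟩
  rw [← h1]
  exact (AlgEquiv.ofInjective f hinj).trdeg_eq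

variable {k : Type u} [Field k] {X : Scheme.{u}} (s : X ⟶ Spec (CommRingCat.of k))

theorem algebraMap_algebraOfPoint_comp {A B : CommRingCat.{u}} (f : Spec A ⟶ X) (g : A ⟶ B) (r : k) :
    (algebraOfPoint s (Spec.map g ≫ f)).algebraMap r = g.hom ((algebraOfPoint s f).algebraMap r) := by
  change (Spec.preimage ((Spec.map g ≫ f) ≫ s)).hom r = g.hom ((Spec.preimage (f ≫ s)).hom r)
  have : Spec.preimage ((Spec.map g ≫ f) ≫ s) = Spec.preimage (f ≫ s) ≫ g := by
    apply Spec.map_injective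
    rw [Spec.map_comp, Spec.map_preimage, Spec.map_preimage, Category.assoc]
  rw [this]
  rfl

/-- The homomorphism of `k`-algebras given by a morphism of points. -/
def algHomOfPoint {A B : CommRingCat.{u}} (f : Spec A ⟶ X) (h : Spec B ⟶ X) (g : A ⟶ B)
    (hg : Spec.map g ≫ f = h) :
    letI := algebraOfPoint s f
    letI := algebraOfPoint s h
    A →ₐ[k] B :=
  letI := algebraOfPoint s f
  letI := algebraOfPoint s h
  { g.hom with
    commutes' := fun r => by
      subst hg
      exact (algebraMap_algebraOfPoint_comp s f g r).symm }

theorem finiteType_algebraOfPoint_fromSpec [LocallyOfFiniteType s] {U : X.Opens}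
    (hU : IsAffineOpen U) :
    letI := algebraOfPoint s hU.fromSpec
    Algebra.FiniteType k Γ(X, U) := by
  have h : LocallyOfFiniteType (Spec.map (Spec.preimage (hU.fromSpec ≫ s))) := by
    rw [Spec.map_preimage]; infer_instance
  exact (HasRingHomProperty.Spec_iff (P := @LocallyOfFiniteType)).mp h

theorem ringKrullDim_le_topologicalKrullDim {U : X.Opens} (hU : IsAffineOpen U) :
    ringKrullDim Γ(X, U) ≤ topologicalKrullDim X := by
  rw [← PrimeSpectrum.topologicalKrullDim_eq_ringKrullDim]
  exact hU.fromSpec.isOpenEmbedding.isInducing.topologicalKrullDim_le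

theorem AlgebraicGeometry.IsAffineOpen.SpecMap_germ_fromSpec {U : X.Opens} (hU : IsAffineOpen U) {x : X} (hx : x ∈ U) :
    Spec.map (X.presheaf.germ U x hx) ≫ hU.fromSpec = X.fromSpecStalk x :=
  hU.fromSpecStalk_eq_fromSpecStalk hx

variable [IsIntegral X]

theorem genericPoint_mem_of_mem {U : X.Opens} {x : X} (hx : x ∈ U) : genericPoint X ∈ U :=
  ((genericPoint_spec X).mem_open_set_iff U.isOpen).mpr ⟨x, trivial, hx⟩

theorem isFractionRing_functionField {U : X.Opens} (hU : IsAffineOpen U) [Nonempty U] :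
    IsFractionRing Γ(X, U) X.functionField :=
  functionField_isFractionRing_of_isAffineOpen X U hU

theorem isScalarTower_functionField {U : X.Opens} (hU : IsAffineOpen U) [Nonempty U] :
    letI := algebraOfPoint s hU.fromSpec
    letI := functionFieldAlgebra s
    IsScalarTower k Γ(X, U) X.functionField := by
  let := algebraOfPoint s hU.fromSpec
  let := functionFieldAlgebra s
  refine .of_algebraMap_eq fun r => ?_
  have hη : genericPoint X ∈ U := genericPoint_mem_of_mem ‹Nonempty U›.some.2
  have h := algebraMap_algebraOfPoint_comp s hU.fromSpec (X.presheaf.germ U _ hη) r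
  rw [hU.SpecMap_germ_fromSpec] at h
  exact h

theorem trdeg_functionField_le_two [LocallyOfFiniteType s] (hX : topologicalKrullDim X = 2) :
    letI := functionFieldAlgebra s
    Algebra.trdeg k X.functionField ≤ 2 := by
  let := functionFieldAlgebra s
  obtain ⟨_, ⟨U, hU, rfl⟩, hx, -⟩ := X.isBasis_affineOpens.exists_subset_of_mem_open
    (Set.mem_univ (genericPoint X)) isOpen_univ
  have hU : IsAffineOpen U := hU
  have : Nonempty U := ⟨⟨_, hx⟩⟩
  let := algebraOfPoint s hU.fromSpec
  have := finiteType_algebraOfPoint_fromSpec s hU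
  have := isFractionRing_functionField hU
  have := isScalarTower_functionField s hU
  have h1 := ringKrullDim_le_topologicalKrullDim hU
  obtain ⟨n, h2, h3⟩ := exists_ringKrullDim_eq_and_trdeg_eq k Γ(X, U)
  rw [trdeg_eq_of_isFractionRing k Γ(X, U) X.functionField, h3]
  rw [hX, h2] at h1
  exact_mod_cast h1

theorem essFiniteType_functionField [LocallyOfFiniteType s] :
    letI := functionFieldAlgebra s
    Algebra.EssFiniteType k X.functionField := by
  let := functionFieldAlgebra s
  obtain ⟨_, ⟨U, hU, rfl⟩, hx, -⟩ := X.isBasis_affineOpens.exists_subset_of_mem_open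
    (Set.mem_univ (genericPoint X)) isOpen_univ
  have hU : IsAffineOpen U := hU
  have : Nonempty U := ⟨⟨_, hx⟩⟩
  let := algebraOfPoint s hU.fromSpec
  have := finiteType_algebraOfPoint_fromSpec s hU
  have := isFractionRing_functionField hU
  have := isScalarTower_functionField s hU
  have : Algebra.EssFiniteType Γ(X, U) X.functionField :=
    .of_isLocalization _ (nonZeroDivisors Γ(X, U))
  exact .comp k Γ(X, U) X.functionField

/-- On a surface, a point whose residue field has transcendence degree two is the generic point. -/
theorem eq_genericPoint_of_trdeg_residueField [LocallyOfFiniteType s]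
    (hX : topologicalKrullDim X = 2) (x : X)
    (hx : letI := algebraOfPoint s (X.fromSpecResidueField x);
      Algebra.trdeg k (X.residueField x) = 2) :
    x = genericPoint X ∧ (letI := functionFieldAlgebra s;
      Algebra.trdeg k X.functionField = 2) := by
  let := functionFieldAlgebra s
  let := algebraOfPoint s (X.fromSpecResidueField x)
  obtain ⟨_, ⟨U, hU, rfl⟩, hxU, -⟩ := X.isBasis_affineOpens.exists_subset_of_mem_open
    (Set.mem_univ x) isOpen_univ
  have hU : IsAffineOpen U := hU
  have : Nonempty U := ⟨⟨_, hxU⟩⟩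
  let := algebraOfPoint s hU.fromSpec
  have := finiteType_algebraOfPoint_fromSpec s hU
  have := isFractionRing_functionField hU
  have := isScalarTower_functionField s hU
  have h1 := ringKrullDim_le_topologicalKrullDim hU
  let f : Γ(X, U) →ₐ[k] X.residueField x :=
    algHomOfPoint s hU.fromSpec (X.fromSpecResidueField x) (X.evaluation U x hxU) (by
      rw [← Scheme.germ_residue, Spec.map_comp, Category.assoc, hU.SpecMap_germ_fromSpec]
      rfl)
  have hf : ∀ z, ∃ a b, z = f a / f b := by
    intro z
    obtain ⟨w, rfl⟩ := X.residue_surjective x z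
    let : Algebra Γ(X, U) (X.presheaf.stalk x) := X.presheaf.algebra_section_stalk ⟨x, hxU⟩
    have hloc : IsLocalization (hU.primeIdealOf ⟨x, hxU⟩).asIdeal.primeCompl
        (X.presheaf.stalk x) := hU.isLocalization_stalk ⟨x, hxU⟩
    obtain ⟨⟨a, b⟩, hab⟩ := IsLocalization.surj
      (hU.primeIdealOf ⟨x, hxU⟩).asIdeal.primeCompl w
    refine ⟨a, b, ?_⟩
    have hab' : w * X.presheaf.germ U x hxU b = X.presheaf.germ U x hxU a := hab
    have h2 := congrArg (X.residue x) hab'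
    rw [map_mul] at h2
    have h3 : IsUnit (X.residue x (X.presheaf.germ U x hxU b)) :=
      (IsLocalization.map_units (X.presheaf.stalk x) b).map (X.residue x).hom
    exact eq_div_of_mul_eq h3.ne_zero h2
  rw [hX] at h1
  obtain ⟨h2, h3⟩ := injective_and_trdeg_eq_two_of_ringKrullDim_le f hf hx h1
  refine ⟨?_, by rw [trdeg_eq_of_isFractionRing k Γ(X, U) X.functionField, h3]⟩
  -- A function nonvanishing at the generic point is nonzero, so by injectivity of `f` it does not
  -- vanish at `x`. Thus `x` lies in every neighbourhood of the generic point.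
  have h4 : x ⤳ genericPoint X := by
    rw [specializes_iff_forall_open]
    intro W hW hηW
    obtain ⟨g, hgW, hηg⟩ := hU.exists_basicOpen_le (V := ⟨W, hW⟩) ⟨_, hηW⟩
      (genericPoint_mem_of_mem hxU)
    refine hgW ((X.evaluation_ne_zero_iff_mem_basicOpen x hxU g).mp fun h0 => ?_)
    have hg : g = 0 := (injective_iff_map_eq_zero f).mp h2 g h0
    rw [hg, Scheme.basicOpen_zero] at hηg
    exact hηg
  exact (((genericPoint_spec X).specializes (Set.mem_univ x)).antisymm h4).eq.symm

end Dimension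
end



/-! ### From rational curves to embeddings of function fields. -/

noncomputable section

section RationalCurve

/-- The extension `K(t) / K` does not give a monomorphism of schemes. -/
theorem not_mono_SpecMap_ratFunc_C (K : Type u) [Field K] :
    ¬ Mono (Spec.map (CommRingCat.ofHom (RatFunc.C : K →+* RatFunc K))) := by
  intro h
  -- The substitution `t ↦ t + 1` is a nontrivial `K`-automorphism, so `Spec K(t) ⟶ Spec K`
  -- equalizes two distinct maps.
  let σ : RatFunc K ≃+* RatFunc K :=
    IsFractionRing.ringEquivOfRingEquiv (Polynomial.algEquivAevalXAddC (1 : K)).toRingEquiv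
  have hσ : ∀ p : Polynomial K, σ (algebraMap _ _ p) =
      algebraMap _ _ (Polynomial.algEquivAevalXAddC (1 : K) p) := fun p =>
    IsFractionRing.ringEquivOfRingEquiv_algebraMap _ _
  have h1 : Spec.map (CommRingCat.ofHom σ.toRingHom) ≫ Spec.map (CommRingCat.ofHom RatFunc.C) =
      𝟙 _ ≫ Spec.map (CommRingCat.ofHom (RatFunc.C : K →+* RatFunc K)) := by
    rw [Category.id_comp, ← Spec.map_comp]
    congr 1
    ext c
    change σ (RatFunc.C c) = RatFunc.C c
    rw [← RatFunc.algebraMap_C, hσ]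
    simp
  have h2 := (cancel_mono _).mp h1
  rw [← Spec.map_id] at h2
  have h3 : σ (algebraMap (Polynomial K) _ Polynomial.X) = algebraMap (Polynomial K) _ Polynomial.X :=
    congrArg (fun f => f.hom (algebraMap (Polynomial K) (RatFunc K) Polynomial.X))
      (Spec.map_injective h2)
  rw [hσ] at h3
  have h4 := IsFractionRing.injective (Polynomial K) (RatFunc K) h3
  simp at h4

theorem Spec_comp_injective {A B : CommRingCat.{u}} {R : CommRingCat.{u}} {f : A ⟶ B}
    (hf : Function.Injective f) {a b : Spec A ⟶ Spec R} (h : Spec.map f ≫ a = Spec.map f ≫ b) :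
    a = b := by
  obtain ⟨a, rfl⟩ := Spec.map_surjective a
  obtain ⟨b, rfl⟩ := Spec.map_surjective b
  rw [← Spec.map_comp, ← Spec.map_comp] at h
  congr 1
  ext x
  exact hf (congrArg (fun g => g.hom x) (Spec.map_injective h))

variable {k : Type u} [Field k] {X : Scheme.{u}} (s : X ⟶ Spec (CommRingCat.of k))
  {K : Type u} [Field K] [Algebra k K]

theorem exists_eq_SpecMap_comp_fromSpecStalk {R : Type u} [CommRing R] [IsLocalRing R]
    (ψ : Spec (CommRingCat.of R) ⟶ X) {x : X} (hx : ψ (IsLocalRing.closedPoint R) = x) :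
    ∃ φ : X.presheaf.stalk x →+* R, Spec.map (CommRingCat.ofHom φ) ≫ X.fromSpecStalk x = ψ := by
  subst hx
  exact ⟨(Scheme.stalkClosedPointTo ψ).hom, Scheme.Spec_stalkClosedPointTo_fromSpecStalk ψ⟩

/-- If all values were constant, they would define a `K`-point of `X_K` through which `m` factors,
making `Spec K(t) ⟶ Spec K` a monomorphism. -/
theorem exists_ne_C_of_mono [IsIntegral X] (m : Spec (CommRingCat.of (RatFunc K)) ⟶
      pullback s (specExt k K)) [Mono m]
    (hm : m ≫ pullback.snd s (specExt k K) = Spec.map (CommRingCat.ofHom RatFunc.C)) {x : X}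
    (φ : X.presheaf.stalk x →+* RatFunc K)
    (hφ : Spec.map (CommRingCat.ofHom φ) ≫ X.fromSpecStalk x = m ≫ pullback.fst s (specExt k K)) :
    ∃ a, ¬ ∃ c, φ a = RatFunc.C c := by
  by_contra! h
  choose φ₀ hφ₀ using h
  have hC : Function.Injective (RatFunc.C : K →+* RatFunc K) := RingHom.injective _
  let θ : X.presheaf.stalk x →+* K :=
    { toFun := φ₀
      map_one' := hC (by rw [← hφ₀, map_one, map_one])
      map_zero' := hC (by rw [← hφ₀, map_zero, map_zero])
      map_add' := fun a b => hC (by rw [← hφ₀, map_add, map_add, hφ₀, hφ₀])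
      map_mul' := fun a b => hC (by rw [← hφ₀, map_mul, map_mul, hφ₀, hφ₀]) }
  have hθ : φ = RatFunc.C.comp θ := RingHom.ext hφ₀
  rw [hθ, CommRingCat.ofHom_comp, Spec.map_comp, Category.assoc] at hφ
  have h1 : (Spec.map (CommRingCat.ofHom θ) ≫ X.fromSpecStalk x) ≫ s = 𝟙 _ ≫ specExt k K := by
    apply Spec_comp_injective (f := CommRingCat.ofHom (RatFunc.C : K →+* RatFunc K)) hC
    rw [← Category.assoc, hφ, Category.assoc, pullback.condition, ← Category.assoc, hm,
      Category.id_comp]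
  have h2 : Spec.map (CommRingCat.ofHom RatFunc.C) ≫ pullback.lift _ _ h1 = m := by
    apply pullback.hom_ext
    · rw [Category.assoc, pullback.lift_fst, hφ]
    · rw [Category.assoc, pullback.lift_snd, hm, Category.comp_id]
  exact not_mono_SpecMap_ratFunc_C K (mono_of_mono_fac h2)

theorem SpecMap_algebraMap_ratFunc_closedPoint (K : Type u) [Field K] :
    Spec.map (CommRingCat.ofHom (algebraMap (Polynomial K) (RatFunc K)))
      (IsLocalRing.closedPoint (RatFunc K)) =
        genericPoint (Spec (CommRingCat.of (Polynomial K))) := by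
  rw [genericPoint_eq_bot_of_affine]
  apply PrimeSpectrum.ext
  change Ideal.comap _ (IsLocalRing.maximalIdeal _) = ⊥
  rw [IsLocalRing.maximalIdeal_eq_bot]
  exact (RingHom.injective_iff_ker_eq_bot _).mp (IsFractionRing.injective _ _)

/-- A rational curve has a parametrization by the generic point of the line. -/
theorem exists_mono_of_isRationalCurve {C Z : Scheme.{u}} {z : Z ⟶ Spec (CommRingCat.of K)}
    {i : C ⟶ Z} (hi : IsRationalCurve z i) :
    ∃ m : Spec (CommRingCat.of (RatFunc K)) ⟶ Z, Mono m ∧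
      m ≫ z = Spec.map (CommRingCat.ofHom RatFunc.C) ∧
        ∀ c, m (IsLocalRing.closedPoint (RatFunc K)) ⤳ i c := by
  have := hi.integral
  have := hi.closedImmersion
  obtain ⟨f, hf⟩ := hi.birational.trans
    (Scheme.Hom.birationalOver _ _ _ (projLineChart_comp_str K)).symm
  let l := Spec.map (CommRingCat.ofHom (algebraMap (Polynomial K) (RatFunc K)))
  have hl : l (IsLocalRing.closedPoint (RatFunc K)) = genericPoint _ :=
    SpecMap_algebraMap_ratFunc_closedPoint K
  have : Epi (CommRingCat.ofHom (algebraMap (Polynomial K) (RatFunc K))) :=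
    IsLocalization.epi (nonZeroDivisors (Polynomial K)) _
  have hlmono : Mono l := inferInstanceAs (Mono (Scheme.Spec.map
    (CommRingCat.ofHom (algebraMap (Polynomial K) (RatFunc K))).op))
  obtain ⟨v, hv⟩ := f.dense_target.nonempty
  have hV := genericPoint_mem_of_mem (X := Spec (CommRingCat.of (Polynomial K))) hv
  have : Nonempty f.target := ⟨⟨v, hv⟩⟩
  obtain ⟨w, hw⟩ := f.dense_source.nonempty
  have : Nonempty f.source := ⟨⟨w, hw⟩⟩
  have hrange : Set.range l ⊆ Set.range f.target.ι := by
    rintro _ ⟨y, rfl⟩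
    rw [Scheme.Opens.range_ι, Subsingleton.elim y (IsLocalRing.closedPoint (RatFunc K)), hl]
    exact hV
  let n := IsOpenImmersion.lift f.target.ι l hrange
  have hn : n ≫ f.target.ι = l := IsOpenImmersion.lift_fac _ _ _
  have : Mono (n ≫ f.target.ι) := hn ▸ hlmono
  have : Mono n := mono_of_mono n f.target.ι
  -- Every factor is a monomorphism: `n` because localizations are epimorphisms of rings, the others
  -- as an isomorphism, an open immersion and a closed immersion.
  refine ⟨n ≫ f.iso.inv ≫ f.source.ι ≫ i, inferInstance, ?_, fun c => ?_⟩
  · have h1 : f.iso.hom ≫ f.target.ι ≫ Spec.map (CommRingCat.ofHom Polynomial.C) =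
      f.source.ι ≫ i ≫ z := hf
    rw [Category.assoc, Category.assoc, Category.assoc, ← h1, Iso.inv_hom_id_assoc,
      reassoc_of% hn, ← Spec.map_comp]
    congr 1
  · have h1 : n (IsLocalRing.closedPoint (RatFunc K)) = genericPoint f.target := by
      apply f.target.ι.isOpenEmbedding.injective
      rw [genericPoint_eq_of_isOpenImmersion, ← hl, ← hn]
      rfl
    have h2 : (n ≫ f.iso.inv ≫ f.source.ι ≫ i) (IsLocalRing.closedPoint (RatFunc K)) =
        i (genericPoint C) := by
      change i (f.source.ι (f.iso.inv (n (IsLocalRing.closedPoint (RatFunc K))))) = _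
      rw [h1, genericPoint_eq_of_isOpenImmersion, genericPoint_eq_of_isOpenImmersion]
    rw [h2]
    exact ((genericPoint_spec C).specializes (Set.mem_univ c)).map i.continuous

/-- A rational curve through the generic point of a variety gives a nonconstant embedding of the
function field into a field of rational functions. -/
theorem RationalCurveThrough.exists_algHom [IsIntegral X] {P : Spec (CommRingCat.of K) ⟶ X}
    {hP : P ≫ s = specExt k K} (h : RationalCurveThrough s P hP)
    (hη : P (IsLocalRing.closedPoint K) = genericPoint X) :
    ∃ φ : X.functionField →+* RatFunc K,
      (∀ r : k, φ ((functionFieldAlgebra s).algebraMap r) = RatFunc.C (algebraMap k K r)) ∧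
      ∃ a, ¬ ∃ c, φ a = RatFunc.C c := by
  obtain ⟨C, i, hi, c, hc⟩ := h
  obtain ⟨m, hmono, hm, hmc⟩ := exists_mono_of_isRationalCurve hi
  have h1 : (m ≫ pullback.fst s (specExt k K)) (IsLocalRing.closedPoint (RatFunc K)) =
      genericPoint X := by
    have h2 := (hmc c).map (pullback.fst s (specExt k K)).continuous
    rw [hc] at h2
    change _ ⤳ (pullback.lift P (𝟙 _) (by simpa using hP) ≫ pullback.fst s (specExt k K)) _ at h2
    rw [pullback.lift_fst, hη] at h2
    exact (h2.antisymm ((genericPoint_spec X).specializes (Set.mem_univ _))).eq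
  obtain ⟨φ, hφ⟩ := exists_eq_SpecMap_comp_fromSpecStalk _ h1
  refine ⟨φ, fun r => ?_, exists_ne_C_of_mono s m hm φ hφ⟩
  have h3 : X.fromSpecStalk (genericPoint X) ≫ s =
    Spec.map (CommRingCat.ofHom (functionFieldAlgebra s).algebraMap) := (Spec.map_preimage _).symm
  have h4 := congrArg (· ≫ s) hφ
  simp only [Category.assoc, h3, pullback.condition] at h4
  rw [reassoc_of% hm, ← Spec.map_comp, ← Spec.map_comp] at h4
  exact congrArg (fun g => g.hom r) (Spec.map_injective h4)

end RationalCurve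
end



/-! ### Properness and centres of valuations. -/

noncomputable section

attribute [local instance] MvPolynomial.gradedAlgebra

section Proper

variable {k : Type u} [Field k]

theorem algebraMap_homogeneousSubmodule_zero_surjective {σ : Type*} :
    Function.Surjective (algebraMap k (MvPolynomial.homogeneousSubmodule σ k 0)) := by
  rintro ⟨p, hp⟩
  obtain ⟨a, rfl⟩ : ∃ a, p = MvPolynomial.C a :=
    ⟨_, MvPolynomial.totalDegree_eq_zero_iff_eq_C.mp
      ((MvPolynomial.totalDegree_zero_iff_isHomogeneous σ).mpr hp)⟩
  exact ⟨a, rfl⟩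

instance isProper_projSpaceStr (n : ℕ) : IsProper (projSpaceStr n k) := by
  have : IsScalarTower k (MvPolynomial.homogeneousSubmodule (Fin (n + 1)) k 0)
      (MvPolynomial (Fin (n + 1)) k) :=
    .of_algebraMap_eq (R := k) (S := MvPolynomial.homogeneousSubmodule (Fin (n + 1)) k 0)
      (A := MvPolynomial (Fin (n + 1)) k) fun _ => rfl
  have : Algebra.FiniteType (MvPolynomial.homogeneousSubmodule (Fin (n + 1)) k 0)
      (MvPolynomial (Fin (n + 1)) k) := .of_restrictScalars_finiteType k _ _
  have : IsClosedImmersion (Spec.map (CommRingCat.ofHom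
      (algebraMap k (MvPolynomial.homogeneousSubmodule (Fin (n + 1)) k 0)))) :=
    IsClosedImmersion.spec_of_surjective _ algebraMap_homogeneousSubmodule_zero_surjective
  have : IsProper (Proj.toSpecZero (MvPolynomial.homogeneousSubmodule (Fin (n + 1)) k)) :=
    inferInstance
  exact MorphismProperty.comp_mem _ _ _ this inferInstance

theorem IsProjectiveOverField.isProper {X : Scheme.{u}} {s : X ⟶ Spec (CommRingCat.of k)}
    (hs : IsProjectiveOverField s) : IsProper s := by
  obtain ⟨n, i, hi, rfl⟩ := hs
  infer_instance

/-- A valuation ring of an extension of the function field of a proper `k`-scheme that contains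
`k` dominates a point of the scheme. -/
theorem exists_forall_mem_localSubring_of_valuationSubring {X : Scheme.{u}} [IsIntegral X]
    (s : X ⟶ Spec (CommRingCat.of k)) [IsProper s] {E : Type u} [Field E]
    (φ : X.functionField →+* E) (V : ValuationSubring E)
    (hV : ∀ r : k, φ ((functionFieldAlgebra s).algebraMap r) ∈ V) :
    ∃ x : X, ∀ a ∈ localSubring X x, φ a ∈ V := by
  let ψ : k →+* V := (φ.comp (functionFieldAlgebra s).algebraMap).codRestrict V hV
  have hsq : CommSq (Spec.map (CommRingCat.ofHom φ) ≫ X.fromSpecStalk (genericPoint X))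
      (Spec.map (CommRingCat.ofHom (algebraMap V E))) s (Spec.map (CommRingCat.ofHom ψ)) := by
    constructor
    have h : X.fromSpecStalk (genericPoint X) ≫ s =
      Spec.map (CommRingCat.ofHom (functionFieldAlgebra s).algebraMap) :=
        (Spec.map_preimage _).symm
    rw [Category.assoc, h, ← Spec.map_comp, ← Spec.map_comp]
    rfl
  have hs : ValuativeCriterion s := by
    have : IsProper s := inferInstance
    rw [IsProper.eq_valuativeCriterion] at this
    exact this.1.1.1
  obtain ⟨l, hl⟩ : ∃ l : Spec (CommRingCat.of V) ⟶ X,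
      Spec.map (CommRingCat.ofHom (algebraMap V E)) ≫ l =
        Spec.map (CommRingCat.ofHom φ) ≫ X.fromSpecStalk (genericPoint X) := by
    obtain ⟨⟨l, hl, -⟩⟩ := (hs.existence ⟨V, E, _, _, hsq⟩).exists_lift
    exact ⟨l, hl⟩
  -- The centre of the valuation: the lift `l` from the valuative criterion sends the local ring
  -- there into `V`, compatibly with `φ`.
  refine ⟨l (IsLocalRing.closedPoint V), ?_⟩
  rintro _ ⟨a, rfl⟩
  have h := (genericPoint_spec X).specializes (Set.mem_univ (l (IsLocalRing.closedPoint V)))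
  rw [← Scheme.SpecMap_stalkSpecializes_fromSpecStalk h] at hl
  have h1 := congrArg (fun f => Spec.map (CommRingCat.ofHom (algebraMap V E)) ≫ f)
    (Scheme.Spec_stalkClosedPointTo_fromSpecStalk l)
  have h2 := h1.trans hl
  simp only [← Category.assoc] at h2
  have h3 := (cancel_mono _).mp h2
  rw [← Spec.map_comp, ← Spec.map_comp] at h3
  have h4 : algebraMap V E (Scheme.stalkClosedPointTo l a) = φ (algebraMap _ _ a) :=
    congrArg (fun f => f.hom a) (Spec.map_injective h3)
  exact h4 ▸ (Scheme.stalkClosedPointTo l a).2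

end Proper
end



/-! ### Dominant rational maps from `ℙ¹ × Y`. -/

noncomputable section

section Uniruled

variable {k : Type u} [Field k]

/-- The chart `𝔸¹ × Spec A` of `ℙ¹ × Spec A`. -/
def projLineProdChart (k A : Type u) [Field k] [CommRing A] [Algebra k A] :
    Spec (CommRingCat.of (Polynomial A)) ⟶
      pullback (projSpaceStr 1 k) (Spec.map (CommRingCat.ofHom (algebraMap k A))) :=
  pullback.lift (Spec.map (CommRingCat.ofHom (Polynomial.mapRingHom (algebraMap k A))) ≫
    projLineChart k) (Spec.map (CommRingCat.ofHom Polynomial.C)) (by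
      rw [Category.assoc, projLineChart_comp_str, ← Spec.map_comp, ← Spec.map_comp,
        ← CommRingCat.ofHom_comp, ← CommRingCat.ofHom_comp]
      congr 2
      ext r
      simp)

theorem isPullback_polynomial (A : Type u) [CommRing A] [Algebra k A] :
    IsPullback (Spec.map (CommRingCat.ofHom (Polynomial.mapRingHom (algebraMap k A))))
      (Spec.map (CommRingCat.ofHom (Polynomial.C : A →+* _)))
      (Spec.map (CommRingCat.ofHom (Polynomial.C : k →+* _)))
      (Spec.map (CommRingCat.ofHom (algebraMap k A))) := by
  apply isPullback_SpecMap_of_isPushout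
  let : Algebra (Polynomial k) (Polynomial A) := (Polynomial.mapRingHom (algebraMap k A)).toAlgebra
  have : IsScalarTower k (Polynomial k) (Polynomial A) := .of_algebraMap_eq fun r =>
    (Polynomial.map_C (algebraMap k A)).symm
  exact CommRingCat.isPushout_iff_isPushout.mpr inferInstance

/-- By pasting, this follows from `A[t] = A ⊗ k[t]` and the square defining the product. It makes
the product chart a base change of the chart of `ℙ¹`. -/
theorem isPullback_projLineProdChart (A : Type u) [CommRing A] [Algebra k A] :
    IsPullback (Spec.map (CommRingCat.ofHom (Polynomial.mapRingHom (algebraMap k A))))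
      (projLineProdChart k A) (projLineChart k) (pullback.fst _ _) := by
  refine IsPullback.of_bot (v₂₁ := pullback.snd _ _) (v₂₂ := projSpaceStr 1 k)
    (h₃₁ := Spec.map (CommRingCat.ofHom (algebraMap k A))) ?_ ?_ ?_
  · rw [projLineChart_comp_str, projLineProdChart, pullback.lift_snd]
    exact isPullback_polynomial A
  · rw [projLineProdChart, pullback.lift_fst]
  · exact (IsPullback.of_hasPullback _ _).flip.flip

instance (A : Type u) [CommRing A] [Algebra k A] : IsOpenImmersion (projLineProdChart k A) :=
  MorphismProperty.of_isPullback (P := @IsOpenImmersion) (isPullback_projLineProdChart A)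
    inferInstance

/-- The range is the preimage of a dense open set under the projection to `ℙ¹`, which is an open map
as a base change of a flat morphism of finite presentation. -/
instance (A : Type u) [CommRing A] [Algebra k A] [Algebra.FiniteType k A] :
    IsDominant (projLineProdChart k A) := by
  have h := isPullback_projLineProdChart (k := k) A
  have : UniversallyOpen (Spec.map (CommRingCat.ofHom (algebraMap k A))) := by
    have : Flat (Spec.map (CommRingCat.ofHom (algebraMap k A))) := by
      rw [HasRingHomProperty.Spec_iff (P := @Flat)]
      exact (RingHom.flat_algebraMap_iff).mpr inferInstance
    have : LocallyOfFinitePresentation (Spec.map (CommRingCat.ofHom (algebraMap k A))) := by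
      rw [HasRingHomProperty.Spec_iff (P := @LocallyOfFinitePresentation)]
      exact (RingHom.finitePresentation_algebraMap).mpr
        (Algebra.FinitePresentation.of_finiteType.mp inferInstance)
    exact UniversallyOpen.of_flat _
  constructor
  rw [DenseRange, ← h.isoPullback_hom_snd, Scheme.Hom.comp_base, TopCat.coe_comp,
    Set.range_comp, (Scheme.Hom.surjective _).range_eq, Set.image_univ, Scheme.Pullback.range_snd]
  exact (projLineChart k).denseRange.preimage
    (Scheme.Hom.isOpenMap (pullback.fst _ (Spec.map (CommRingCat.ofHom (algebraMap k A)))))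

/-- The composition of the inverse of a birational map with a dominant rational map, over a
base. -/
theorem exists_isDominant_rationalMap_of_partialIso {P Q X S : Scheme.{u}} [IrreducibleSpace P]
    [IrreducibleSpace Q] [Nonempty X] {sP : P ⟶ S} {sQ : Q ⟶ S} {s : X ⟶ S} (g : P.PartialIso Q)
    (hg : g.IsOver sP sQ) (f : Q.RationalMap X) [f.IsDominant]
    (hf : f.compHom s = sQ.toRationalMap) :
    ∃ f' : P.RationalMap X, f'.IsDominant ∧ f'.compHom s = sP.toRationalMap := by
  have : IsDominant g.toPartialMap.hom := by
    have := Opens.isDominant_ι g.dense_target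
    exact inferInstanceAs (IsDominant (g.iso.hom ≫ g.target.ι))
  have : Nonempty S := ‹Nonempty X›.map s
  refine ⟨g.toRationalMap.comp f, inferInstance, ?_⟩
  rw [← Scheme.RationalMap.comp_toRationalMap, Scheme.RationalMap.comp_assoc,
    Scheme.RationalMap.comp_toRationalMap, hf, Scheme.RationalMap.comp_toRationalMap,
    ← Scheme.RationalMap.compHom_toRationalMap]
  refine Scheme.PartialMap.toRationalMap_eq_iff.mpr ⟨g.source, g.dense_source, le_rfl, le_top, ?_⟩
  have hg' : g.iso.hom ≫ g.target.ι ≫ sQ = g.source.ι ≫ sP := hg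
  change P.homOfLE _ ≫ (g.iso.hom ≫ g.target.ι) ≫ sQ = P.homOfLE _ ≫ P.topIso.hom ≫ sP
  simp [hg']

theorem isDominant_of_fromFunctionField {Q X : Scheme.{u}} [IrreducibleSpace Q]
    [IrreducibleSpace X] (f : Q.RationalMap X) (y) (hy : f.fromFunctionField y = genericPoint X) :
    f.IsDominant := by
  obtain ⟨f, rfl⟩ := f.exists_rep
  rw [Scheme.PartialMap.isDominant_toRationalMap_iff]
  constructor
  have h : genericPoint X ∈ Set.range f.hom := ⟨_, hy⟩
  rw [DenseRange, dense_iff_closure_eq, Set.eq_univ_iff_forall]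
  exact fun x => closure_mono (Set.singleton_subset_iff.mpr h)
    (((genericPoint_spec X).specializes (Set.mem_univ x)).mem_closure)

/-- An embedding of function fields over `k` gives a dominant rational map. -/
theorem exists_isDominant_rationalMap_of_functionField {Q X : Scheme.{u}} [IsIntegral Q]
    [IsIntegral X] (sQ : Q ⟶ Spec (CommRingCat.of k)) (s : X ⟶ Spec (CommRingCat.of k))
    [LocallyOfFiniteType s] (γ : X.functionField →+* Q.functionField)
    (hγ : ∀ r, γ ((functionFieldAlgebra s).algebraMap r) = (functionFieldAlgebra sQ).algebraMap r) :
    ∃ f : Q.RationalMap X, f.IsDominant ∧ f.compHom s = sQ.toRationalMap := by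
  have h : (Spec.map (CommRingCat.ofHom γ) ≫ X.fromSpecStalk (genericPoint X)) ≫ s =
      Q.fromSpecStalk (genericPoint Q) ≫ sQ := by
    have h1 : X.fromSpecStalk (genericPoint X) ≫ s =
      Spec.map (CommRingCat.ofHom (functionFieldAlgebra s).algebraMap) :=
        (Spec.map_preimage _).symm
    have h2 : Q.fromSpecStalk (genericPoint Q) ≫ sQ =
      Spec.map (CommRingCat.ofHom (functionFieldAlgebra sQ).algebraMap) :=
        (Spec.map_preimage _).symm
    rw [Category.assoc, h1, h2, ← Spec.map_comp]
    congr 1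
    ext r
    exact hγ r
  obtain ⟨f, hf⟩ := Scheme.RationalMap.equivFunctionField sQ s ⟨_, h⟩
  refine ⟨_, isDominant_of_fromFunctionField _ (IsLocalRing.closedPoint Q.functionField) ?_,
    (Scheme.RationalMap.equivFunctionField sQ s ⟨_, h⟩).2⟩
  refine (congrArg (fun q : Spec Q.functionField ⟶ X => q (IsLocalRing.closedPoint _))
    (Scheme.RationalMap.fromFunctionField_ofFunctionField sQ s _ h)).trans ?_
  have : IsLocalHom (CommRingCat.ofHom γ).hom := inferInstanceAs (IsLocalHom γ)
  exact (congrArg (X.fromSpecStalk (genericPoint X)) (Spec_closedPoint (f := CommRingCat.ofHom γ))).trans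
    Scheme.fromSpecStalk_closedPoint

theorem exists_ringHom_functionField_Spec (R : CommRingCat.{u}) [IsDomain R] (L : Type u) [Field L]
    [Algebra R L] [IsFractionRing R L] : ∃ e : L →+* (Spec R).functionField,
      Spec.map (CommRingCat.ofHom (e.comp (algebraMap R L))) =
        (Spec R).fromSpecStalk (genericPoint (Spec R)) := by
  let e := IsLocalization.algEquiv (nonZeroDivisors R) L (Spec R).functionField
  refine ⟨e.toRingEquiv.toRingHom, ?_⟩
  rw [Spec.fromSpecStalk_eq']
  congr 1
  ext r
  exact e.commutes r

/-- A surface whose function field embeds into that of a cylinder over a curve is uniruled. -/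
theorem isUniruled_of_algHom {X : Scheme.{u}} [IsIntegral X] (s : X ⟶ Spec (CommRingCat.of k))
    [LocallyOfFiniteType s] (hX : topologicalKrullDim X = 2) {A : Type u} [CommRing A] [IsDomain A]
    [Algebra k A] [Algebra.FiniteType k A] (hA : ringKrullDim A = 1)
    (γ : X.functionField →+* FractionRing (Polynomial A))
    (hγ : ∀ r : k, γ ((functionFieldAlgebra s).algebraMap r) = algebraMap k _ r) :
    IsUniruled s := by
  let t : Spec (CommRingCat.of A) ⟶ Spec (CommRingCat.of k) :=
    Spec.map (CommRingCat.ofHom (algebraMap k A))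
  let Q := Spec (CommRingCat.of (Polynomial A))
  let sQ : Q ⟶ Spec (CommRingCat.of k) :=
    Spec.map (CommRingCat.ofHom (algebraMap k (Polynomial A)))
  refine ⟨Spec (CommRingCat.of A), t, ⟨inferInstance, inferInstance, ?_, inferInstance⟩, ?_, ?_⟩
  · rw [HasRingHomProperty.Spec_iff (P := @LocallyOfFiniteType)]
    exact RingHom.finiteType_algebraMap.mpr inferInstance
  · rw [hX]
    refine (congrArg (· + 1) ((PrimeSpectrum.topologicalKrullDim_eq_ringKrullDim A).trans hA)).trans ?_
    exact one_add_one_eq_two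
  · obtain ⟨e, he⟩ := exists_ringHom_functionField_Spec (CommRingCat.of (Polynomial A))
      (FractionRing (Polynomial A))
    obtain ⟨f, hf, hfs⟩ := exists_isDominant_rationalMap_of_functionField sQ s (e.comp γ) (fun r => by
      have h1 : Q.fromSpecStalk (genericPoint Q) ≫ sQ = Spec.map (CommRingCat.ofHom
          ((e.comp (algebraMap (Polynomial A) (FractionRing (Polynomial A)))).comp
            (algebraMap k (Polynomial A)))) := by
        rw [CommRingCat.ofHom_comp, Spec.map_comp]
        exact congrArg (· ≫ sQ) he.symm
      have h2 := congrArg Spec.preimage h1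
      rw [Spec.preimage_map] at h2
      rw [RingHom.comp_apply, hγ, IsScalarTower.algebraMap_apply k (Polynomial A)]
      exact (congrArg (fun g => g.hom r) h2).symm)
    have hj : projLineProdChart k A ≫ (pullback.snd (projSpaceStr 1 k) t ≫ t) = sQ := by
      rw [projLineProdChart, pullback.lift_snd_assoc, ← Spec.map_comp]
      rfl
    obtain ⟨g, hg⟩ := (Scheme.Hom.birationalOver (projLineProdChart k A) _ _ hj).symm
    -- The product is the closure of the image of the irreducible chart `Spec A[t]`.
    have : IrreducibleSpace (pullback (projSpaceStr 1 k) t : Scheme.{u}) := by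
      rw [irreducibleSpace_def, Set.top_eq_univ, ← (projLineProdChart k A).denseRange.closure_range]
      have h := (IrreducibleSpace.isIrreducible_univ Q).image (projLineProdChart k A)
        (projLineProdChart k A).continuous.continuousOn
      rw [Set.image_univ] at h
      exact h.closure
    exact exists_isDominant_rationalMap_of_partialIso g hg f hfs

end Uniruled
end



/-! ### The main theorem. -/

section Main

/-- A surface with a nonconstant embedding of its function field into a field of rational functions
is not of general type. -/
theorem not_isOfGeneralType_of_ratFunc {k : Type u} [Field k] [CharZero k] {X : Scheme.{u}}
    [IsIntegral X] (s : X ⟶ Spec (CommRingCat.of k)) [IsProper s]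
    (hX : topologicalKrullDim X = 2) {K : Type u} [Field K] [Algebra k K]
    (φ : X.functionField →+* RatFunc K)
    (hφ : ∀ r : k, φ ((functionFieldAlgebra s).algebraMap r) = RatFunc.C (algebraMap k K r))
    (hne : ∃ a, ¬ ∃ c, φ a = RatFunc.C c) : ¬ IsOfGeneralType s := by
  rintro ⟨m, hm, h⟩
  let := functionFieldAlgebra s
  let ψ : X.functionField →ₐ[k] RatFunc K := { φ with commutes' := hφ }
  let S : Set X.functionField := {f | ∃ v ∈ pluricanonicalSections s m,
    ∃ w ∈ pluricanonicalSections s m, v ≠ 0 ∧ w = f • v}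
  have h2 : Algebra.trdeg k (IntermediateField.adjoin k S) = 2 := h
  have := essFiniteType_functionField s
  -- The dimension of `X` bounds the transcendence degree above; the two-dimensional pluricanonical
  -- image bounds it below.
  have htr : Algebra.trdeg k X.functionField = 2 := by
    refine le_antisymm (trdeg_functionField_le_two s hX) (h2 ▸ ?_)
    exact trdeg_le_of_injective (IntermediateField.val _) (RingHom.injective _)
  have h3 : ∀ w ∈ pluricanonicalSections s m, w = 0 := fun w hw =>
    pluriform_eq_zero_of_forall_valuationSubring ψ htr hne hm w fun V hV => by
      obtain ⟨x, hx⟩ := exists_forall_mem_localSubring_of_valuationSubring s φ V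
        fun r => by rw [hφ]; exact hV _
      exact ⟨localSubring X x, hx, hw x⟩
  have h4 : S = ∅ := by
    rw [Set.eq_empty_iff_forall_notMem]
    rintro f ⟨v, hv, -, -, hv0, -⟩
    exact hv0 (h3 v hv)
  -- Without nonzero sections there are no quotients, so the generated field is `k`, of
  -- transcendence degree zero.
  rw [h4, IntermediateField.adjoin_empty, trdeg_eq_zero] at h2
  exact absurd h2 (by norm_num)

theorem genericKPoint_closedPoint {X : Scheme.{u}} [IsIntegral X] {K : Type u} [Field K]
    (e : X.functionField →+* K) :
    genericKPoint X e (IsLocalRing.closedPoint K) = genericPoint X := by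
  have : IsLocalHom (CommRingCat.ofHom e).hom := inferInstanceAs (IsLocalHom e)
  exact (congrArg (X.fromSpecStalk (genericPoint X))
    (Spec_closedPoint (f := CommRingCat.ofHom e))).trans Scheme.fromSpecStalk_closedPoint

theorem mainTheorem3 {k : Type u} [Field k] {X : Scheme.{u}} [IsIntegral X]
    (s : X ⟶ Spec (CommRingCat.of k)) (hX : IsSmoothProjectiveSurface s) :
    (∀ (K : Type u) [Field K] [Algebra k K] (P : Spec (CommRingCat.of K) ⟶ X)
        (hP : P ≫ s = specExt k K),
      pointTrdeg s P = 2 → RationalCurveThrough s P hP → IsUniruled s) ∧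
    (CharZero k → IsOfGeneralType s →
      (∀ (K : Type u) [Field K] [Algebra k K] (P : Spec (CommRingCat.of K) ⟶ X)
        (hP : P ≫ s = specExt k K), pointTrdeg s P = 2 → ¬ RationalCurveThrough s P hP) ∧
      (∀ (K : Type u) [Field K] [Algebra k K] (e : X.functionField →+* K)
        (he : genericKPoint X e ≫ s = specExt k K),
          ¬ RationalCurveThrough s (genericKPoint X e) he)) := by
  have := hX.projective.isProper
  refine ⟨fun K _ _ P hP htr hc => ?_, fun _ hg => ⟨fun K _ _ P hP htr hc => ?_,
    fun K _ _ e he hc => ?_⟩⟩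
  · obtain ⟨hη, htr⟩ := eq_genericPoint_of_trdeg_residueField s hX.dim_eq _ htr
    obtain ⟨φ, hφ, hne⟩ := hc.exists_algHom s hη
    let := functionFieldAlgebra s
    have := essFiniteType_functionField s
    obtain ⟨A, _, _, _, _, hA, ⟨γ⟩⟩ := exists_curve_algHom_of_algHom_ratFunc
      ({ φ with commutes' := hφ } : X.functionField →ₐ[k] RatFunc K) htr hne
    exact isUniruled_of_algHom s hX.dim_eq hA γ.toRingHom γ.commutes
  · obtain ⟨hη, -⟩ := eq_genericPoint_of_trdeg_residueField s hX.dim_eq _ htr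
    obtain ⟨φ, hφ, hne⟩ := hc.exists_algHom s hη
    exact not_isOfGeneralType_of_ratFunc s hX.dim_eq φ hφ hne hg
  -- The point lies over `η` by construction, so its transcendence degree need not be computed.
  · obtain ⟨φ, hφ, hne⟩ := hc.exists_algHom s (genericKPoint_closedPoint e)
    exact not_isOfGeneralType_of_ratFunc s hX.dim_eq φ hφ hne hg

end Main
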